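/- Let $\mathbb{K}$ be a number field with ring of integers $\mathcal{O}_{\mathbb{K}}$, let $\mathcal{N}$ denote the norm of ideals, and let $k\ge 2$ be an integer. For a nonzero ideal $\mathfrak{I}=\prod_{i=1}^{l}\mathfrak{p}_i^{\alpha_i}$ of $\mathcal{O}_{\mathbb{K}}$, with distinct nonzero prime ideals $\mathfrak{p}_i$ and $\alpha_i\ge 1$, put \[\mathcal{F}_k(\mathfrak{I})=\prod_{i=1}^{l}(\mathcal{N}\mathfrak{p}_i)^{\beta_i},\qquad \beta_i=\begin{cases}\alpha_i, & \alpha_i<k,\\ 1/\alpha_i, & \alpha_i\ge k.\end{cases}\] Let $\zeta_{\mathbb{K}}$ be the Dedekind zeta function of $\mathbb{K}$, let $\lambda_{\mathbb{K}}$ be its residue at $s=1$, and let $R_k(s)=\prod_{\mathfrak{p}}(1+A_{\mathfrak{p}}(s))$, where $\mathfrak{p}$ runs over the nonzero prime ideals of $\mathcal{O}_{\mathbb{K}}$ and \[A_{\mathfrak{p}}(s)=\frac{(\mathcal{N}\mathfrak{p})^{-(ks-\frac1k)}\sum_{m=0}^{\infty}(\mathcal{N}\mathfrak{p})^{-(ms+\frac1k-\frac1{k+m})}}{\sum_{j=0}^{k-1}(\mathcal{N}\mathfrak{p})^{-j(s-1)}}.\]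 Then the series and the product defining $R_k(2)$ converge, and there is a constant $C$, depending only on $\mathbb{K}$ and $k$, such that for all real $x\ge 2$ \[\Bigl|\sum_{\substack{0\ne\mathfrak{I}\subset\mathcal{O}_{\mathbb{K}}\\ \mathcal{N}(\mathfrak{I})\le x}}\mathcal{F}_k(\mathfrak{I})-\frac{x^2\lambda_{\mathbb{K}}R_k(2)}{2\zeta_{\mathbb{K}}(k)}\Bigr|\le C\,\frac{x^2}{\log x}.\] -/

import Mathlib

open NumberField IsDedekindDomain

noncomputable section

namespace IrrationalFactor

/-- The exponent `β` attached to a multiplicity `α`: it is `α` if `α < k`, and `1 / α` if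
`k ≤ α`. -/
def beta (k α : ℕ) : ℝ := if α < k then (α : ℝ) else 1 / (α : ℝ)

variable (K : Type*) [Field K] [NumberField K]

open Classical in
/-- The irrational factor function of order `k` at a nonzero ideal `I` of the ring of integers:
the product of `(N 𝔭) ^ β` over the distinct prime ideals `𝔭` dividing `I`, where `β` is the
exponent attached to the multiplicity of `𝔭` in `I`. -/
def irrationalFactor (k : ℕ) (I : Ideal (𝓞 K)) : ℝ :=
  ∏ 𝔭 ∈ (UniqueFactorizationMonoid.normalizedFactors I).toFinset,
    (Ideal.absNorm 𝔭 : ℝ) ^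
      beta k ((UniqueFactorizationMonoid.normalizedFactors I).count 𝔭)

theorem finite_ideals_absNorm_le (x : ℝ) :
    {I : Ideal (𝓞 K) | I ≠ ⊥ ∧ (Ideal.absNorm I : ℝ) ≤ x}.Finite := by
  refine (Ideal.finite_setOfPred_absNorm_le (S := 𝓞 K) ⌊x⌋₊).subset ?_
  rintro I ⟨-, hI⟩
  exact Nat.le_floor hI

/-- The sum of the irrational factor function of order `k` over all nonzero ideals of norm at
most `x`. -/
def irrationalFactorSum (k : ℕ) (x : ℝ) : ℝ :=
  ∑ I ∈ (finite_ideals_absNorm_le K x).toFinset, irrationalFactor K k I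

variable {K}

/-- The `m`-th term of the series in the numerator of the local term at `𝔭`. -/
def localTerm (k : ℕ) (s : ℂ) (𝔭 : HeightOneSpectrum (𝓞 K)) (m : ℕ) : ℂ :=
  1 / (Ideal.absNorm 𝔭.asIdeal : ℂ) ^ ((m : ℂ) * s + 1 / (k : ℂ) - 1 / ((k : ℂ) + (m : ℂ)))

/-- The local term `A_𝔭(s)` at a nonzero prime ideal `𝔭`. -/
def localA (k : ℕ) (s : ℂ) (𝔭 : HeightOneSpectrum (𝓞 K)) : ℂ :=
  (1 / (Ideal.absNorm 𝔭.asIdeal : ℂ) ^ ((k : ℂ) * s - 1 / (k : ℂ)) *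
      ∑' m : ℕ, localTerm k s 𝔭 m) /
    ∑ j ∈ Finset.range k, 1 / (Ideal.absNorm 𝔭.asIdeal : ℂ) ^ ((j : ℂ) * (s - 1))

variable (K)

/-- The product `R_k(s)` of `1 + A_𝔭(s)` over all nonzero prime ideals `𝔭`. -/
def eulerR (k : ℕ) (s : ℂ) : ℂ := ∏' 𝔭 : HeightOneSpectrum (𝓞 K), (1 + localA k s 𝔭)

end IrrationalFactor

end

/-! Write `F_k` as a Dirichlet convolution `h * N` over nonzero ideals. Dividing by the norm locally
gives `h(𝔭^(n+1)) = F_k(𝔭^(n+1)) - N𝔭 · F_k(𝔭^n)`. Since `k ≥ 2`, `h(𝔭) = 0`, and `|h(𝔭^n)| ≤ N𝔭^n`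
always (`localH_one`, `abs_localH_le`). Hence `∑ h(𝔞) N𝔞^(-(1+θ))` converges absolutely for every `θ
≥ 3/4` (`summable_prod_localH`).

The sum of `F_k` up to `x` is then `∑ h(𝔞) S(x / N𝔞)`, where `S(y)` is the sum of the norms of
ideals of norm at most `y`. With `λ` the residue and `d` the degree, inserting `S(y) = λ y²/2 +
O(y^(1+θ))` for `θ = 1 - 1/(4d)` gives the main term `(λ x²/2) ∑ h(𝔞) N𝔞^(-2)` and an error
`O(x^(1+θ))`, which is stronger than the required `x² / log x`. The Euler factor of `∑ h(𝔞) N𝔞^(-2)`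
at `𝔭` is `(1 - N𝔭^(-k))(1 + A_𝔭(2))` (`tsum_localH_mul`), so this sum is `R_k(2) / ζ_K(k)`.

The estimate for `S` follows by partial summation from the ideal count `λ s + O(s^θ)`
(`exists_idealCount_estimate`). That count is proved one ideal class at a time, by counting points
of an ideal lattice in the fundamental cone. In logarithmic coordinates the cone becomes a box, and
a bounded displacement of a large point moves these coordinates very little. The lattice points are
therefore trapped between two slightly different boxes of explicit volume
(`exists_card_coneBox_estimate`). -/

noncomputable section

namespace IrrationalFactor

/-! ### Comparing lattice point counts with volumes -/

section LatticeCount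

open MeasureTheory
open scoped Pointwise

variable {E : Type*} [NormedAddCommGroup E] [MeasurableSpace E] [BorelSpace E]
  {μ : Measure E} [μ.IsAddLeftInvariant] {L : Submodule ℤ E} {D T U : Set E}

/-- Packing: the translates of `D` by the lattice points of `T` are almost disjoint, have equal
measure and lie in `U`. The next lemma is the covering counterpart. -/
theorem card_inter_mul_measure_le (hD : IsAddFundamentalDomain L D μ) (hfin : (T ∩ L).Finite)
    (hTU : ∀ x ∈ T, ∀ d ∈ D, x + d ∈ U) : ((T ∩ L).ncard : ENNReal) * μ D ≤ μ U := by
  classical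
  have : MeasurableVAdd L E := (inferInstance : MeasurableVAdd L.toAddSubgroup E)
  have : VAddInvariantMeasure L E μ := (inferInstance : VAddInvariantMeasure L.toAddSubgroup E μ)
  let F : Finset L := (hfin.preimage Subtype.val_injective.injOn).toFinset
  have hF : ∀ v : L, v ∈ F ↔ (v : E) ∈ T := by
    intro v
    simp [F]
  have hcard : (T ∩ L).ncard = F.card := by
    rw [← Set.ncard_coe_finset, ← Set.ncard_image_of_injective _ Subtype.val_injective]
    congr 1
    ext x
    constructor
    · rintro ⟨h1, h2⟩
      exact ⟨⟨x, h2⟩, by simpa [hF] using h1, rfl⟩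
    · rintro ⟨v, hv, rfl⟩
      exact ⟨(hF v).1 hv, v.2⟩
  have hsum : μ (⋃ v ∈ F, (v +ᵥ D : Set E)) = ∑ v ∈ F, μ (v +ᵥ D : Set E) :=
    measure_biUnion_finset₀ (fun v _ w _ hvw ↦ hD.aedisjoint hvw)
      (fun v _ ↦ hD.nullMeasurableSet_vadd v)
  simp only [measure_vadd, Finset.sum_const, nsmul_eq_mul] at hsum
  rw [hcard, ← hsum]
  refine measure_mono (Set.iUnion₂_subset fun v hv ↦ ?_)
  rintro _ ⟨d, hd, rfl⟩
  exact hTU _ ((hF v).1 hv) d hd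

theorem measure_le_card_inter_mul (hD : IsAddFundamentalDomain L D μ) (hfin : (T ∩ L).Finite)
    (hUT : ∀ x, ∀ d ∈ D, x + d ∈ U → x ∈ T) : μ U ≤ ((T ∩ L).ncard : ENNReal) * μ D := by
  classical
  have : MeasurableVAdd L E := (inferInstance : MeasurableVAdd L.toAddSubgroup E)
  have : VAddInvariantMeasure L E μ := (inferInstance : VAddInvariantMeasure L.toAddSubgroup E μ)
  let F : Finset E := hfin.toFinset
  have hle : μ U ≤ μ (⋃ v ∈ F, (v +ᵥ D : Set E)) := by
    refine measure_mono_ae ?_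
    -- Covering provides `g` with `g + x ∈ D`, so the translate that contains `x` is the one by
    -- `-g`.
    filter_upwards [hD.ae_covers] with x ⟨g, hg⟩ hx
    have hx' : ((-g : L) : E) + (g +ᵥ x) = x := by
      simp [Submodule.vadd_def]
    refine Set.mem_iUnion₂.2 ⟨((-g : L) : E), ?_, ⟨_, hg, hx'⟩⟩
    simp only [F, Set.Finite.mem_toFinset]
    refine ⟨hUT _ _ hg ?_, (-g).2⟩
    rwa [hx']
  refine hle.trans ((measure_biUnion_finset_le _ _).trans ?_)
  simp only [measure_vadd, Finset.sum_const, nsmul_eq_mul]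
  rw [Set.ncard_eq_toFinset_card _ hfin]

end LatticeCount

/-! ### The fundamental cone in logarithmic coordinates -/

section ConeBox

open NumberField.mixedEmbedding NumberField.mixedEmbedding.fundamentalCone
  NumberField.InfinitePlace NumberField.Units NumberField.Units.dirichletUnitTheorem MeasureTheory
open scoped Classical

variable (K : Type*) [Field K] [NumberField K]

/-- A box in the logarithmic coordinates of `expMapBasis`. -/
def paramBox (a b ε : ℝ) : Set (realSpace K) :=
  Set.univ.pi fun w ↦ if w = w₀ then Set.Ioc a b else Set.Ico (-ε) (1 + ε)

/-- The part of the mixed space whose logarithmic coordinates lie in `paramBox`. -/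
def coneBox (a b ε : ℝ) : Set (mixedSpace K) :=
  normAtAllPlaces ⁻¹' (expMapBasis '' paramBox K a b ε)

variable {K}

theorem mem_paramBox {a b ε : ℝ} {p : realSpace K} :
    p ∈ paramBox K a b ε ↔ (a < p w₀ ∧ p w₀ ≤ b) ∧ ∀ w, w ≠ w₀ → -ε ≤ p w ∧ p w < 1 + ε := by
  classical
  simp only [paramBox, Set.mem_univ_pi]
  refine ⟨fun h ↦ ⟨by simpa using h w₀, fun w hw ↦ by simpa [hw] using h w⟩, fun h w ↦ ?_⟩
  split_ifs with hw
  · exact hw ▸ h.1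
  · exact h.2 w hw

theorem measurableSet_paramBox (a b ε : ℝ) : MeasurableSet (paramBox K a b ε) := by
  refine MeasurableSet.univ_pi fun _ ↦ ?_
  split_ifs
  · exact measurableSet_Ioc
  · exact measurableSet_Ico

/-- The integrand depends on the `w₀` coordinate alone, so Fubini leaves one exponential integral
times the lengths `1 + 2 * ε` of the other sides. -/
theorem setLIntegral_paramBox_exp {n : ℕ} (hn : 0 < n) {a b ε : ℝ} (hab : a ≤ b)
    (hε : 0 ≤ 1 + 2 * ε) :
    ∫⁻ (x : realSpace K) in paramBox K a b ε, .ofReal (Real.exp (x w₀ * n)) =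
      ENNReal.ofReal ((1 + 2 * ε) ^ (Fintype.card {w : InfinitePlace K // w ≠ w₀}) *
        ((Real.exp (n * b) - Real.exp (n * a)) / n)) := by
  have hn : 0 < (n : ℝ) := Nat.cast_pos.mpr hn
  rw [volume_pi, paramBox, Measure.restrict_pi_pi, lintegral_eq_lmarginal_univ 0,
    lmarginal_erase' _ (by fun_prop) (Finset.mem_univ w₀), if_pos rfl]
  have h1 : ∫⁻ x in Set.Ioc a b, ENNReal.ofReal (Real.exp (x * n)) =
      ENNReal.ofReal ((Real.exp (n * b) - Real.exp (n * a)) / n) := by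
    rw [← ofReal_integral_eq_lintegral_ofReal]
    · rw [← intervalIntegral.integral_of_le hab]
      congr 1
      rw [intervalIntegral.integral_comp_mul_right _ hn.ne', integral_exp]
      simp [mul_comm, div_eq_inv_mul]
    · exact (Continuous.integrableOn_Ioc (by fun_prop))
    · filter_upwards with _ using Real.exp_nonneg _
  have hcard : Fintype.card {w : InfinitePlace K // w ≠ w₀} =
      (Finset.univ.erase (w₀ : InfinitePlace K)).card := by
    rw [Fintype.card_subtype]
    congr 1
    ext w
    simp
  simp_rw [Function.update_self, lmarginal, lintegral_const, h1, Measure.pi_univ, if_neg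
    (Finset.ne_of_mem_erase (Subtype.prop _)), Measure.restrict_apply_univ, Real.volume_Ico]
  rw [Finset.prod_const, Finset.card_univ, Fintype.card_coe, ← hcard, ENNReal.ofReal_mul (by positivity),
    ENNReal.ofReal_pow hε, mul_comm]
  ring_nf

variable (K) in
/-- The constant of proportionality in the volume of `coneBox`. -/
def coneConst : ℝ :=
  2 ^ nrRealPlaces K * Real.pi ^ nrComplexPlaces K * regulator K

variable (K) in
theorem coneConst_pos : 0 < coneConst K := by
  have := regulator_pos K
  have := Real.pi_pos
  unfold coneConst
  positivity

variable (K) in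
/-- The number of infinite places other than the distinguished one. -/
def unitRank : ℕ :=
  Fintype.card {w : InfinitePlace K // w ≠ w₀}

/-- In the coordinates of `expMapBasis` the density is a constant times `exp (d * p w₀)`, the
weights at the complex places cancelling. The result is exact, also for negative `ε`, which the
inner box requires. -/
theorem volume_coneBox {a b ε : ℝ} (hab : a ≤ b) (hε : 0 ≤ 1 + 2 * ε) :
    volume (coneBox K a b ε) = ENNReal.ofReal (coneConst K * ((1 + 2 * ε) ^ unitRank K *
      (Real.exp (Module.finrank ℚ K * b) - Real.exp (Module.finrank ℚ K * a)))) := by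
  classical
  have hm : MeasurableSet (coneBox K a b ε) := by
    refine MeasurableSet.preimage ?_ (continuous_normAtAllPlaces K).measurable
    exact (measurableSet_paramBox a b ε).image_of_continuousOn_injOn
      (continuous_expMapBasis K).continuousOn (injective_expMapBasis K).injOn
  have hd : (0 : ℝ) < Module.finrank ℚ K := Nat.cast_pos.mpr Module.finrank_pos
  unfold coneBox at hm ⊢
  rw [volume_eq_two_pow_mul_two_pi_pow_mul_integral Set.preimage_image_preimage hm,
    normAtAllPlaces_image_preimage_expMapBasis,
    setLIntegral_expMapBasis_image (measurableSet_paramBox a b ε) (by fun_prop)]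
  simp_rw [ENNReal.inv_mul_cancel_right
    (Finset.prod_ne_zero_iff.mpr fun _ _ ↦ ENNReal.ofReal_ne_zero_iff.mpr (expMapBasis_pos _ _))
    (ENNReal.prod_ne_top fun _ _ ↦ ENNReal.ofReal_ne_top)]
  rw [setLIntegral_paramBox_exp Module.finrank_pos hab hε]
  have e1 : (2 : ENNReal) ^ nrRealPlaces K = ENNReal.ofReal (2 ^ nrRealPlaces K) := by
    rw [ENNReal.ofReal_pow (by norm_num)]; simp
  have e2 : (2 : ENNReal)⁻¹ ^ nrComplexPlaces K = ENNReal.ofReal (2⁻¹ ^ nrComplexPlaces K) := by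
    rw [ENNReal.ofReal_pow (by norm_num), ENNReal.ofReal_inv_of_pos (by norm_num)]; simp
  have e3 : ((Module.finrank ℚ K : ℕ) : ENNReal) = ENNReal.ofReal (Module.finrank ℚ K : ℝ) := by
    simp
  have := Real.pi_pos
  have := regulator_pos K
  rw [e1, e2, e3, ← ENNReal.ofReal_pow (by positivity), ← ENNReal.ofReal_mul (by positivity),
    ← ENNReal.ofReal_mul (by positivity), ← ENNReal.ofReal_mul (by positivity),
    ← ENNReal.ofReal_mul (by positivity), ← ENNReal.ofReal_mul (by positivity)]
  congr 1
  rw [coneConst, unitRank, mul_pow, inv_pow]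
  field_simp

/-- The logarithmic coordinates of a point of the mixed space. -/
def logCoord (x : mixedSpace K) : realSpace K :=
  (completeBasis K).equivFunL fun w ↦ (w.mult : ℝ) * Real.log (normAtPlace w x)

theorem expMapBasis_logCoord {x : mixedSpace K} (hx : ∀ w, 0 < normAtPlace w x) :
    expMapBasis (logCoord x) = normAtAllPlaces x := by
  ext w
  rw [expMapBasis_apply, logCoord]
  have : (completeBasis K).equivFun.symm ((completeBasis K).equivFunL fun w ↦
      (w.mult : ℝ) * Real.log (normAtPlace w x)) =
      fun w ↦ (w.mult : ℝ) * Real.log (normAtPlace w x) :=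
    (completeBasis K).equivFun.symm_apply_apply _
  rw [this, expMap_apply, inv_mul_cancel_left₀ mult_coe_ne_zero, Real.exp_log (hx w)]

theorem mem_coneBox {a b ε : ℝ} {x : mixedSpace K} :
    x ∈ coneBox K a b ε ↔ (∀ w, 0 < normAtPlace w x) ∧ logCoord x ∈ paramBox K a b ε := by
  constructor
  · rintro ⟨p, hp, hpx⟩
    have hpos : ∀ w, 0 < normAtPlace w x := fun w ↦ by
      rw [← normAtAllPlaces_apply, ← hpx]; exact expMapBasis_pos p w
    refine ⟨hpos, ?_⟩
    rw [← expMapBasis_logCoord hpos] at hpx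
    rwa [← injective_expMapBasis K hpx]
  · rintro ⟨h1, h2⟩
    exact ⟨_, h2, expMapBasis_logCoord h1⟩

/-- For `ε = 0` the sides `[0, 1)` are exactly those of the fundamental domain for the units modulo
torsion, and the norm is `exp (d * p w₀)`. The half-open ends thus match the cone with no boundary
correction. -/
theorem mem_coneBox_zero {a b : ℝ} {x : mixedSpace K} :
    x ∈ coneBox K a b 0 ↔ x ∈ fundamentalCone K ∧
      Real.exp (Module.finrank ℚ K * a) < mixedEmbedding.norm x ∧
      mixedEmbedding.norm x ≤ Real.exp (Module.finrank ℚ K * b) := by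
  have hd : (0 : ℝ) < Module.finrank ℚ K := Nat.cast_pos.mpr Module.finrank_pos
  by_cases hpos : ∀ w, 0 < normAtPlace w x
  · have h := expMapBasis_logCoord hpos
    have hn := norm_expMapBasis (logCoord x)
    rw [h, norm_normAtAllPlaces, ← Real.exp_nat_mul] at hn
    have hl := logMap_expMapBasis (logCoord x)
    rw [h, logMap_normAtAllPlaces] at hl
    rw [mem_coneBox, mem_paramBox, fundamentalCone, Set.mem_sdiff, Set.mem_preimage, hl, hn,
      Set.mem_ofPred_eq, hn, Real.exp_lt_exp, Real.exp_le_exp, mul_lt_mul_iff_right₀ hd,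
      mul_le_mul_iff_right₀ hd]
    simp only [Real.exp_ne_zero, neg_zero, add_zero, Set.mem_Ico]
    tauto
  · refine ⟨fun h ↦ (hpos (mem_coneBox.1 h).1).elim,
      fun h ↦ (hpos fun w ↦ normAtPlace_pos_of_mem h.1 w).elim⟩

variable (K) in
-- The coordinate `w₀` acts by scaling with `exp`, and the remaining coordinates stay in a compact
-- cube, on which the continuous positive `expMapBasis` is bounded above and away from zero. The
-- range `[-1, 2]` covers every `ε ≤ 1`.
theorem exists_normAtPlace_bounds : ∃ c C : ℝ, 0 < c ∧ 0 < C ∧ ∀ x : mixedSpace K,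
    (∀ w, 0 < normAtPlace w x) → (∀ w, w ≠ w₀ → -1 ≤ logCoord x w ∧ logCoord x w ≤ 2) →
    ∀ w, c * Real.exp (logCoord x w₀) ≤ normAtPlace w x ∧
      normAtPlace w x ≤ C * Real.exp (logCoord x w₀) := by
  classical
  let Q : Set (realSpace K) := Set.univ.pi fun w ↦ Set.Icc (-1 : ℝ) 2
  have hQ : IsCompact Q := isCompact_univ_pi fun w ↦ isCompact_Icc
  have hQne : Q.Nonempty := ⟨0, fun w _ ↦ by simp⟩
  have hcont : ∀ w : InfinitePlace K, Continuous fun p : realSpace K ↦ expMapBasis p w := fun w ↦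
    (continuous_apply w).comp (continuous_expMapBasis K)
  have hlow : ∀ w : InfinitePlace K, ∃ c : ℝ, 0 < c ∧ ∀ p ∈ Q, c ≤ expMapBasis p w := fun w ↦ by
    obtain ⟨q, hq, hmin⟩ := hQ.exists_isMinOn hQne (hcont w).continuousOn
    exact ⟨_, expMapBasis_pos q w, fun p hp ↦ hmin hp⟩
  have hup : ∀ w : InfinitePlace K, ∃ c : ℝ, 0 < c ∧ ∀ p ∈ Q, expMapBasis p w ≤ c := fun w ↦ by
    obtain ⟨q, hq, hmax⟩ := hQ.exists_isMaxOn hQne (hcont w).continuousOn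
    exact ⟨_, expMapBasis_pos q w, fun p hp ↦ hmax hp⟩
  choose c hc0 hc using hlow
  choose C hC0 hC using hup
  refine ⟨Finset.univ.inf' Finset.univ_nonempty c, Finset.univ.sup' Finset.univ_nonempty C,
    (Finset.lt_inf'_iff _).2 fun w _ ↦ hc0 w,
    (Finset.lt_sup'_iff _).2 ⟨w₀, Finset.mem_univ _, hC0 w₀⟩, fun x hpos hx w ↦ ?_⟩
  let q : realSpace K := fun i ↦ if i = w₀ then 0 else logCoord x i
  have hq : q ∈ Q := by
    intro i _
    by_cases hi : i = w₀
    · simp [q, hi]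
    · simpa [q, hi] using hx i hi
  have h : normAtPlace w x = Real.exp (logCoord x w₀) * expMapBasis q w := by
    rw [← normAtAllPlaces_apply, ← expMapBasis_logCoord hpos, expMapBasis_apply'' (logCoord x)]
    rfl
  rw [h, mul_comm (Real.exp _)]
  constructor
  · gcongr
    exact (Finset.inf'_le _ (Finset.mem_univ w)).trans (hc w q hq)
  · gcongr
    exact (hC w q hq).trans (Finset.le_sup' _ (Finset.mem_univ w))

theorem abs_normAtPlace_sub_le (w : InfinitePlace K) (x y : mixedSpace K) :
    |normAtPlace w y - normAtPlace w x| ≤ ‖y - x‖ := by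
  have key : ∀ z : mixedSpace K, normAtPlace w z ≤ ‖z‖ := fun z ↦ by
    rw [norm_eq_sup'_normAtPlace]
    exact Finset.le_sup' (fun w ↦ normAtPlace w z) (Finset.mem_univ w)
  have h1 := normAtPlace_add_le w x (y - x)
  have h2 := normAtPlace_add_le w y (x - y)
  rw [add_sub_cancel] at h1 h2
  have h3 := key (y - x)
  have h4 := key (x - y)
  rw [norm_sub_rev] at h4
  rw [abs_le]
  constructor <;> linarith

variable (K) in
theorem exists_norm_le_of_mem_coneBox : ∃ C : ℝ, ∀ a b ε : ℝ, ε ≤ 1 → ∀ x ∈ coneBox K a b ε,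
    ‖x‖ ≤ C * Real.exp b := by
  obtain ⟨c, C, -, hC, h⟩ := exists_normAtPlace_bounds K
  refine ⟨C, fun a b ε hε x hx ↦ ?_⟩
  rw [mem_coneBox, mem_paramBox] at hx
  rw [norm_eq_sup'_normAtPlace]
  refine Finset.sup'_le _ _ fun w _ ↦ ?_
  refine (h x hx.1 (fun w hw ↦ ⟨?_, ?_⟩) w).2.trans ?_
  · linarith [(hx.2.2 w hw).1]
  · linarith [(hx.2.2 w hw).2]
  · gcongr
    exact hx.2.1.2

theorem abs_log_sub_log_le {u v r : ℝ} (hu : 0 < u) (hr : 2 * r ≤ u) (h : |v - u| ≤ r) :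
    0 < v ∧ |Real.log v - Real.log u| ≤ 2 * r / u := by
  obtain ⟨h1, h2⟩ := abs_le.1 h
  have hv : 0 < v := by linarith
  have hr0 : 0 ≤ r := (abs_nonneg _).trans h
  refine ⟨hv, abs_le.2 ⟨?_, ?_⟩⟩
  · have h3 := Real.log_le_sub_one_of_pos (div_pos hu hv)
    rw [Real.log_div hu.ne' hv.ne'] at h3
    have : u / v - 1 ≤ 2 * r / u := by
      rw [div_sub_one hv.ne', div_le_div_iff₀ hv hu]
      nlinarith
    linarith
  · have h3 := Real.log_le_sub_one_of_pos (div_pos hv hu)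
    rw [Real.log_div hv.ne' hu.ne'] at h3
    have : v / u - 1 ≤ 2 * r / u := by
      rw [div_sub_one hu.ne']
      gcongr
      linarith
    linarith

variable (K) in
-- Every absolute value of `x` is at least `c * exp (logCoord x w₀)`, so a displacement of length at
-- most `R` changes its logarithm by a multiple of `exp (-logCoord x w₀)`. The coordinates depend
-- linearly on these logarithms.
theorem exists_logCoord_perturb (R : ℝ) (hR : 0 < R) : ∃ A t : ℝ, 0 < A ∧ ∀ x y : mixedSpace K,
    (∀ w, 0 < normAtPlace w x) → (∀ w, w ≠ w₀ → -1 ≤ logCoord x w ∧ logCoord x w ≤ 2) →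
    t ≤ logCoord x w₀ → ‖y - x‖ ≤ R →
    (∀ w, 0 < normAtPlace w y) ∧
      ∀ w, |logCoord y w - logCoord x w| ≤ A * Real.exp (-logCoord x w₀) := by
  obtain ⟨c, _, hc, _, h⟩ := exists_normAtPlace_bounds K
  let e := ((completeBasis K).equivFunL : realSpace K →L[ℝ] realSpace K)
  -- The threshold for `t` makes `R` at most half of every absolute value, as `abs_log_sub_log_le`
  -- demands. The extra factor `2` in the constant bounds the multiplicity of a place.
  refine ⟨(‖e‖ + 1) * (2 * (2 * R / c)), Real.log (2 * R / c), by positivity,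
    fun x y hpos hx ht hyx ↦ ?_⟩
  have hlow := fun w ↦ (h x hpos hx w).1
  have hexp : 2 * R ≤ c * Real.exp (logCoord x w₀) := by
    rw [← div_le_iff₀' hc, ← Real.log_le_iff_le_exp (by positivity)]
    exact ht
  have key := fun w ↦ abs_log_sub_log_le (hpos w) (hexp.trans (hlow w))
    ((abs_normAtPlace_sub_le w x y).trans hyx)
  refine ⟨fun w ↦ (key w).1, fun w ↦ ?_⟩
  let v : realSpace K := fun w ↦ (w.mult : ℝ) * (Real.log (normAtPlace w y) -
    Real.log (normAtPlace w x))
  have hv : logCoord y - logCoord x = e v := by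
    rw [logCoord, logCoord, ← map_sub]
    change e _ = e v
    congr 1
    ext w
    simp only [v, Pi.sub_apply]
    ring
  have hvn : ‖v‖ ≤ 2 * (2 * R / c) * Real.exp (-logCoord x w₀) := by
    rw [pi_norm_le_iff_of_nonneg (by positivity)]
    intro w
    rw [Real.norm_eq_abs, abs_mul, Nat.abs_cast]
    have h1 : (w.mult : ℝ) ≤ 2 := by
      unfold InfinitePlace.mult
      split_ifs <;> norm_num
    have h2 : |Real.log (normAtPlace w y) - Real.log (normAtPlace w x)| ≤
        2 * R / c * Real.exp (-logCoord x w₀) := by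
      refine (key w).2.trans ?_
      rw [Real.exp_neg, ← div_eq_mul_inv, div_div]
      have := hlow w
      gcongr
    rw [mul_assoc]
    exact mul_le_mul h1 h2 (abs_nonneg _) (by norm_num)
  calc |logCoord y w - logCoord x w| = ‖(logCoord y - logCoord x) w‖ := rfl
    _ ≤ ‖logCoord y - logCoord x‖ := norm_le_pi_norm _ w
    _ = ‖e v‖ := by rw [hv]
    _ ≤ ‖e‖ * ‖v‖ := e.le_opNorm v
    _ ≤ (‖e‖ + 1) * (2 * (2 * R / c) * Real.exp (-logCoord x w₀)) := by
        gcongr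
        linarith
    _ = _ := by ring

end ConeBox

/-! ### Counting ideals with a power-saving error -/

section IdealCount

open NumberField.mixedEmbedding NumberField.mixedEmbedding.fundamentalCone
  NumberField.InfinitePlace NumberField.Units NumberField.Units.dirichletUnitTheorem MeasureTheory
  Filter Asymptotics Topology
open scoped Classical nonZeroDivisors

variable (K : Type*) [Field K] [NumberField K]

/-- The image of an ideal in the mixed space. -/
abbrev latticeOf (J : (Ideal (𝓞 K))⁰) : Submodule ℤ (mixedSpace K) :=
  mixedEmbedding.idealLattice K (FractionalIdeal.mk0 K J)

theorem finite_inter_latticeOf (J : (Ideal (𝓞 K))⁰) {s : Set (mixedSpace K)}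
    (hs : Bornology.IsBounded s) : (s ∩ latticeOf K J).Finite := by
  rw [latticeOf, ← span_idealLatticeBasis]
  exact ZSpan.setFinite_inter _ hs

theorem isBounded_coneBox {a b ε : ℝ} (hε : ε ≤ 1) : Bornology.IsBounded (coneBox K a b ε) := by
  obtain ⟨C, h⟩ := exists_norm_le_of_mem_coneBox K
  exact isBounded_iff_forall_norm_le.2 ⟨_, fun x hx ↦ h a b ε hε x hx⟩

theorem finrank_pos_real : (1 : ℝ) ≤ Module.finrank ℚ K :=
  Nat.one_le_cast.2 Module.finrank_pos

theorem upper_volume_estimate (d r : ℕ) {δ a b : ℝ} (hδ : 0 ≤ δ) (hδ1 : δ ≤ 1) :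
    (1 + 2 * δ) ^ r * (Real.exp (d * (b + δ)) - Real.exp (d * a)) ≤
      Real.exp (d * b) + (d + 2 * r) * Real.exp (d + 2 * r) * (δ * Real.exp (d * b)) := by
  have h1 : (1 + 2 * δ) ^ r ≤ Real.exp (2 * r * δ) := by
    have : 1 + 2 * δ ≤ Real.exp (2 * δ) := by linarith [Real.add_one_le_exp (2 * δ)]
    calc (1 + 2 * δ) ^ r ≤ Real.exp (2 * δ) ^ r := by gcongr
      _ = Real.exp (2 * r * δ) := by rw [← Real.exp_nat_mul]; ring_nf
  set c : ℝ := d + 2 * r with hc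
  have hc0 : 0 ≤ c := by positivity
  have h2 : Real.exp (c * δ) ≤ 1 + c * δ * Real.exp c := by
    have h3 := Real.add_one_le_exp (-(c * δ))
    rw [Real.exp_neg] at h3
    have h4 : Real.exp (c * δ) ≤ Real.exp c := Real.exp_le_exp.2 (by nlinarith)
    have h5 := Real.exp_pos (c * δ)
    have h6 : Real.exp (c * δ) * (-(c * δ) + 1) ≤ 1 := by
      calc _ ≤ Real.exp (c * δ) * (Real.exp (c * δ))⁻¹ := by gcongr
        _ = 1 := mul_inv_cancel₀ h5.ne'
    have h7 : c * δ * Real.exp (c * δ) ≤ c * δ * Real.exp c := by gcongr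
    nlinarith
  calc _ ≤ (1 + 2 * δ) ^ r * Real.exp (d * (b + δ)) := by
        gcongr
        linarith [Real.exp_pos (d * a)]
    _ ≤ Real.exp (2 * r * δ) * Real.exp (d * (b + δ)) := by gcongr
    _ = Real.exp (c * δ) * Real.exp (d * b) := by
        rw [← Real.exp_add, ← Real.exp_add, hc]; ring_nf
    _ ≤ (1 + c * δ * Real.exp c) * Real.exp (d * b) := by gcongr
    _ = _ := by ring

theorem lower_volume_estimate (d r : ℕ) {δ a b : ℝ} (hδ : 0 ≤ δ) (hδ1 : δ ≤ 1 / 4) :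
    Real.exp (d * b) - (d + 2 * r) * (δ * Real.exp (d * b)) - Real.exp (d * (a + δ)) ≤
      (1 + 2 * (-δ)) ^ r * (Real.exp (d * (b - δ)) - Real.exp (d * (a + δ))) := by
  set X := (1 + 2 * (-δ)) ^ r
  have hX1 : X ≤ 1 := pow_le_one₀ (by linarith) (by linarith)
  have hX : 1 - 2 * r * δ ≤ X := by
    have := one_add_mul_le_pow (a := 2 * (-δ)) (by linarith) r
    change _ ≤ X at this
    linarith
  set Y := Real.exp (-(d * δ)) with hYdef
  have hY1 : Y ≤ 1 := Real.exp_le_one_iff.2 (by simp; positivity)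
  have hY : 1 - d * δ ≤ Y := by linarith [Real.add_one_le_exp (-(d * δ : ℝ))]
  have hXY : 1 - (d + 2 * r) * δ ≤ X * Y := by
    nlinarith [mul_nonneg (sub_nonneg.2 hX1) (sub_nonneg.2 hY1)]
  have e1 : Real.exp (d * (b - δ)) = Y * Real.exp (d * b) := by
    rw [hYdef, ← Real.exp_add]; ring_nf
  have h1 : (1 - (d + 2 * r) * δ) * Real.exp (d * b) ≤ X * Y * Real.exp (d * b) := by gcongr
  have h2 : X * Real.exp (d * (a + δ)) ≤ 1 * Real.exp (d * (a + δ)) := by gcongr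
  rw [e1]
  linarith

/-- Above height `b / 2`, shifts by the fundamental domain move the coordinates by at most `δ = A *
exp (-b / 2)`. Enlarging and shrinking the box by `δ` changes its volume by `O(δ * exp (d * b))`, a
saving of `exp (b / 2)`. -/
theorem exists_card_coneBox_estimate (J : (Ideal (𝓞 K))⁰) : ∃ α C b₀ : ℝ, ∀ b, b₀ ≤ b →
    |((coneBox K (b / 2) b 0 ∩ latticeOf K J).ncard : ℝ) - α * Real.exp (Module.finrank ℚ K * b)|
      ≤ C * Real.exp ((Module.finrank ℚ K - 1 / 2) * b) := by
  set d := Module.finrank ℚ K with hd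
  set r := unitRank K with hr
  have hd1 : (1 : ℝ) ≤ d := finrank_pos_real K
  let B := fractionalIdealLatticeBasis K (FractionalIdeal.mk0 K J)
  have hD := fundamentalDomain_idealLattice K (FractionalIdeal.mk0 K J)
  have hDb := ZSpan.fundamentalDomain_isBounded B
  obtain ⟨R, hR0, hR⟩ := hDb.exists_pos_norm_le
  obtain ⟨A, t, hA, hpert⟩ := exists_logCoord_perturb K R hR0
  set D := ZSpan.fundamentalDomain B with hDdef
  have hv0 : volume D ≠ 0 := ZSpan.measure_fundamentalDomain_ne_zero B
  have hvt : volume D ≠ ⊤ := hDb.measure_lt_top.ne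
  set v := (volume D).toReal with hv
  have hvpos : 0 < v := ENNReal.toReal_pos hv0 hvt
  set V := coneConst K
  have hV : 0 < V := coneConst_pos K
  set c : ℝ := d + 2 * r with hc
  -- In the threshold, `2 * Real.log (4 * A)` forces `δ ≤ 1 / 4`, then `2` keeps the height range of
  -- the inner box nonempty, and `2 * t` makes the perturbation bound available above height `b /
  -- 2`.
  refine ⟨V / v, V / v * (c * Real.exp c * A + Real.exp d),
    max 2 (max (2 * t) (2 * Real.log (4 * A))), fun b hb ↦ ?_⟩
  simp only [max_le_iff] at hb
  obtain ⟨hb2, hbt, hbA⟩ := hb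
  set δ := A * Real.exp (-(b / 2)) with hδdef
  have hδ0 : 0 ≤ δ := by positivity
  have hδ : δ ≤ 1 / 4 := by
    have h : 4 * A ≤ Real.exp (b / 2) := by
      rw [← Real.log_le_iff_le_exp (by positivity)]
      linarith
    rw [hδdef, Real.exp_neg, ← div_eq_mul_inv, div_le_iff₀ (Real.exp_pos _)]
    linarith
  have hshift : ∀ p : ℝ, b / 2 ≤ p → A * Real.exp (-p) ≤ δ := fun p hp ↦ by
    rw [hδdef]
    gcongr
  have hfin := finite_inter_latticeOf K J (isBounded_coneBox K (a := b / 2) (b := b) zero_le_one)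
  set n := (coneBox K (b / 2) b 0 ∩ latticeOf K J).ncard
  have hup : (n : ℝ) * v ≤ V * (Real.exp (d * b) + c * Real.exp c * (δ * Real.exp (d * b))) := by
    have h := card_inter_mul_measure_le (U := coneBox K (b / 2 - δ) (b + δ) δ) hD hfin ?_
    · rw [volume_coneBox (by linarith) (by linarith)] at h
      have h' := ENNReal.toReal_mono ENNReal.ofReal_ne_top h
      rw [ENNReal.toReal_mul, ENNReal.toReal_natCast, ENNReal.toReal_ofReal'] at h'
      refine h'.trans (max_le ?_ (by positivity))
      gcongr
      exact upper_volume_estimate d r hδ0 (by linarith)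
    · intro x hx y hy
      rw [mem_coneBox, mem_paramBox] at hx
      obtain ⟨h1, h2⟩ := hpert x (x + y) hx.1 (fun w hw ↦ ⟨by linarith [(hx.2.2 w hw).1],
        by linarith [(hx.2.2 w hw).2]⟩) (by linarith [hx.2.1.1]) (by simpa using hR y hy)
      have h3 := fun w ↦ abs_le.1 ((h2 w).trans (hshift _ hx.2.1.1.le))
      rw [mem_coneBox, mem_paramBox]
      refine ⟨h1, ⟨?_, ?_⟩, fun w hw ↦ ⟨?_, ?_⟩⟩
      · linarith [(h3 w₀).1, hx.2.1.1]
      · linarith [(h3 w₀).2, hx.2.1.2]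
      · linarith [(h3 w).1, (hx.2.2 w hw).1]
      · linarith [(h3 w).2, (hx.2.2 w hw).2]
  have hlo : V * (Real.exp (d * b) - c * (δ * Real.exp (d * b)) - Real.exp (d * (b / 2 + δ))) ≤
      n * v := by
    have h := measure_le_card_inter_mul (U := coneBox K (b / 2 + δ) (b - δ) (-δ)) hD hfin ?_
    · rw [volume_coneBox (by linarith) (by linarith)] at h
      have h' := ENNReal.toReal_mono (ENNReal.mul_ne_top (ENNReal.natCast_ne_top _) hvt) h
      rw [ENNReal.toReal_mul, ENNReal.toReal_natCast, ENNReal.toReal_ofReal'] at h'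
      refine le_trans ?_ ((le_max_left _ _).trans h')
      gcongr
      exact lower_volume_estimate d r hδ0 hδ
    · intro x y hy hx
      rw [mem_coneBox, mem_paramBox] at hx
      obtain ⟨h1, h2⟩ := hpert (x + y) x hx.1 (fun w hw ↦ ⟨by linarith [(hx.2.2 w hw).1],
        by linarith [(hx.2.2 w hw).2]⟩) (by linarith [hx.2.1.1]) (by simpa using hR y hy)
      have h3 := fun w ↦ abs_le.1 ((h2 w).trans (hshift _ (by linarith [hx.2.1.1])))
      rw [mem_coneBox, mem_paramBox]
      refine ⟨h1, ⟨?_, ?_⟩, fun w hw ↦ ⟨?_, ?_⟩⟩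
      · linarith [(h3 w₀).1, hx.2.1.1]
      · linarith [(h3 w₀).2, hx.2.1.2]
      · linarith [(h3 w).1, (hx.2.2 w hw).1]
      · linarith [(h3 w).2, (hx.2.2 w hw).2]
  set G := Real.exp ((d - 1 / 2) * b) with hG
  have hG0 : 0 < G := Real.exp_pos _
  have e1 : δ * Real.exp (d * b) = A * G := by
    rw [hδdef, hG, mul_assoc, ← Real.exp_add]
    ring_nf
  -- The lower cut at height `b / 2` is absorbed because `d / 2 ≤ d - 1 / 2`.
  have e2 : Real.exp (d * (b / 2 + δ)) ≤ Real.exp d * G := by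
    rw [hG, ← Real.exp_add, Real.exp_le_exp]
    nlinarith
  rw [e1] at hup hlo
  have hc0 : 0 ≤ c := by positivity
  have hexpc : 1 ≤ Real.exp c := Real.one_le_exp hc0
  have e3 : V / v * Real.exp (d * b) * v = V * Real.exp (d * b) := by field_simp
  have e4 : V / v * (c * Real.exp c * A + Real.exp d) * G * v =
      V * (c * Real.exp c * (A * G) + Real.exp d * G) := by field_simp
  have e5 : c * (A * G) ≤ c * Real.exp c * (A * G) := by
    have : c * 1 * (A * G) ≤ c * Real.exp c * (A * G) := by gcongr
    linarith
  have e6 : 0 ≤ Real.exp d * G := by positivity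
  rw [abs_le]
  constructor
  · refine le_of_mul_le_mul_right ?_ hvpos
    rw [neg_mul, sub_mul, e3, e4]
    refine le_trans ?_ (sub_le_sub_right hlo _)
    have : V * (c * (A * G) + Real.exp (d * (b / 2 + δ))) ≤
      V * (c * Real.exp c * (A * G) + Real.exp d * G) := by gcongr
    linarith
  · refine le_of_mul_le_mul_right ?_ hvpos
    rw [sub_mul, e3, e4]
    refine (sub_le_sub_right hup _).trans ?_
    have : V * (c * Real.exp c * (A * G)) ≤
      V * (c * Real.exp c * (A * G) + Real.exp d * G) := by
        gcongr
        linarith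
    linarith

/-- The number of points of norm at most `X` of an ideal lattice in the fundamental cone. -/
def conePointCount (J : (Ideal (𝓞 K))⁰) (X : ℝ) : ℕ :=
  ({x | x ∈ fundamentalCone K ∧ mixedEmbedding.norm x ≤ X} ∩ latticeOf K J).ncard

theorem isBounded_fundamentalCone_norm_le (X : ℝ) :
    Bornology.IsBounded {x | x ∈ fundamentalCone K ∧ mixedEmbedding.norm x ≤ X} := by
  have hd1 : (1 : ℝ) ≤ Module.finrank ℚ K := finrank_pos_real K
  obtain ⟨C, h⟩ := exists_norm_le_of_mem_coneBox K
  refine isBounded_iff_forall_norm_le.2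
    ⟨C * Real.exp (Real.log (max X 1) / Module.finrank ℚ K), fun x hx ↦ ?_⟩
  have hpos := norm_pos_of_mem hx.1
  -- The lower end of the box may depend on `x`, because the bound involves only the upper end.
  refine h ((Real.log (mixedEmbedding.norm x) - 1) / Module.finrank ℚ K) _ 0 zero_le_one x ?_
  rw [mem_coneBox_zero, mul_div_cancel₀ _ (by positivity), mul_div_cancel₀ _ (by positivity),
    Real.exp_log (by positivity)]
  refine ⟨hx.1, ?_, hx.2.trans (le_max_left _ _)⟩
  rw [← Real.lt_log_iff_exp_lt hpos]
  linarith

/-- The box estimate needs large height, so points of norm at most `√X` are split off. The crude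
linear bound, giving `O(√X)`, suffices for them. -/
theorem conePointCount_eq_add (J : (Ideal (𝓞 K))⁰) {X : ℝ} (hX : 1 ≤ X) :
    conePointCount K J X = conePointCount K J (√X) +
      (coneBox K (Real.log X / Module.finrank ℚ K / 2) (Real.log X / Module.finrank ℚ K) 0 ∩
        latticeOf K J).ncard := by
  have hd1 : (1 : ℝ) ≤ Module.finrank ℚ K := finrank_pos_real K
  have hX0 : 0 < X := by linarith
  have hsq : √X ≤ X := Real.sqrt_le_iff.2 ⟨hX0.le, by nlinarith⟩
  have e1 : Real.exp (Module.finrank ℚ K * (Real.log X / Module.finrank ℚ K / 2)) = √X := by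
    rw [← Real.exp_log (Real.sqrt_pos.2 hX0), Real.log_sqrt hX0.le]
    congr 1
    field_simp
  have e2 : Real.exp (Module.finrank ℚ K * (Real.log X / Module.finrank ℚ K)) = X := by
    rw [mul_div_cancel₀ _ (by positivity), Real.exp_log hX0]
  rw [conePointCount, conePointCount, ← Set.ncard_union_eq ?_
    (finite_inter_latticeOf K J (isBounded_fundamentalCone_norm_le K _))
    (finite_inter_latticeOf K J (isBounded_coneBox K zero_le_one))]
  · congr 1
    ext x
    simp only [Set.mem_inter_iff, Set.mem_union, mem_coneBox_zero, e1, e2, Set.mem_ofPred_eq]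
    by_cases h : mixedEmbedding.norm x ≤ √X
    · have := h.trans hsq
      have := not_lt.2 h
      tauto
    · have := not_le.1 h
      tauto
  · rw [Set.disjoint_left]
    rintro x ⟨⟨-, h1⟩, -⟩ ⟨h2, -⟩
    rw [mem_coneBox_zero, e1] at h2
    exact absurd h1 (not_le.2 h2.2.1)

variable {K} in
-- Multiplication by `J`, which lies in the inverse class, turns the ideals of the class into the
-- principal ideals divisible by `J`.
theorem card_class_norm_le_eq {C : ClassGroup (𝓞 K)} {J : (Ideal (𝓞 K))⁰} {s : ℝ}
    (hJ : ClassGroup.mk0 J = C⁻¹) :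
    Nat.card {I : (Ideal (𝓞 K))⁰ // Ideal.absNorm (I : Ideal (𝓞 K)) ≤ s ∧ ClassGroup.mk0 I = C}
      = Nat.card {I : (Ideal (𝓞 K))⁰ // (J : Ideal (𝓞 K)) ∣ I ∧
        Submodule.IsPrincipal (I : Ideal (𝓞 K)) ∧
        Ideal.absNorm (I : Ideal (𝓞 K)) ≤ s * Ideal.absNorm (J : Ideal (𝓞 K))} := by
  simp_rw [← nonZeroDivisors_dvd_iff_dvd_coe]
  refine Nat.card_congr ?_
  refine ((Equiv.dvd J).subtypeEquiv fun I ↦ ?_).trans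
    (Equiv.subtypeSubtypeEquivSubtypeInter (fun I : (Ideal (𝓞 K))⁰ ↦ J ∣ I) _)
  rw [← ClassGroup.mk0_eq_one_iff (SetLike.coe_mem _)]
  simp_rw [Equiv.dvd_apply, Submonoid.coe_mul, ← Submonoid.mul_def, _root_.map_mul, hJ,
    inv_mul_eq_one, Nat.cast_mul, mul_comm s, eq_comm, and_comm, and_congr_left_iff]
  exact fun _ ↦
    (mul_le_mul_iff_of_pos_left
      (Nat.cast_pos.mpr (Ideal.absNorm_pos_of_nonZeroDivisors J))).symm

/-- The number of ideals of norm at most `s` in an ideal class. -/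
def classCount (C : ClassGroup (𝓞 K)) (s : ℝ) : ℕ :=
  Nat.card {I : (Ideal (𝓞 K))⁰ // Ideal.absNorm (I : Ideal (𝓞 K)) ≤ s ∧ ClassGroup.mk0 I = C}

variable {K} in
-- A principal ideal has exactly `torsionOrder K` generators in the fundamental cone.
theorem classCount_mul_torsionOrder {C : ClassGroup (𝓞 K)} {J : (Ideal (𝓞 K))⁰}
    (hJ : ClassGroup.mk0 J = C⁻¹) (s : ℝ) :
    classCount K C s * torsionOrder K =
      conePointCount K J (s * Ideal.absNorm (J : Ideal (𝓞 K))) := by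
  rw [classCount, card_class_norm_le_eq hJ, card_isPrincipal_dvd_norm_le, conePointCount,
    ← Nat.card_coe_set_eq]
  refine Nat.card_congr ((Equiv.subtypeSubtypeEquivSubtypeInter (· ∈ idealSet K J)
    (fun a ↦ mixedEmbedding.norm a ≤ s * Ideal.absNorm (J : Ideal (𝓞 K)))).trans
      (Equiv.subtypeEquivRight fun a ↦ ?_))
  simp only [idealSet, Set.mem_inter_iff, Set.mem_ofPred_eq, latticeOf]
  tauto

theorem isBigO_classCount (C : ClassGroup (𝓞 K)) :
    (fun s : ℝ ↦ (classCount K C s : ℝ)) =O[atTop] fun s ↦ s := by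
  have h := (NumberField.Ideal.tendsto_norm_le_and_mk_eq_div_atTop K C).isBigO_one ℝ
  have h2 := h.mul (isBigO_refl (fun s : ℝ ↦ s) atTop)
  refine (h2.congr' ?_ ?_)
  · filter_upwards [eventually_ne_atTop 0] with s hs
    rw [classCount, div_mul_cancel₀ _ hs]
  · filter_upwards with s
    rw [one_mul]

theorem isBigO_conePointCount (J : (Ideal (𝓞 K))⁰) :
    (fun X : ℝ ↦ (conePointCount K J X : ℝ)) =O[atTop] fun X ↦ X := by
  have hJ : ClassGroup.mk0 J = ((ClassGroup.mk0 J)⁻¹)⁻¹ := (inv_inv _).symm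
  have hN : (0 : ℝ) < Ideal.absNorm (J : Ideal (𝓞 K)) :=
    Nat.cast_pos.mpr (Ideal.absNorm_pos_of_nonZeroDivisors J)
  have h := (isBigO_classCount K (ClassGroup.mk0 J)⁻¹).comp_tendsto
    (tendsto_id.atTop_mul_const (inv_pos.2 hN))
  have h2 : (fun X : ℝ ↦ (conePointCount K J X : ℝ)) = fun X ↦ (torsionOrder K : ℝ) *
      classCount K (ClassGroup.mk0 J)⁻¹ (X * (Ideal.absNorm (J : Ideal (𝓞 K)) : ℝ)⁻¹) := by
    ext X
    have := classCount_mul_torsionOrder hJ (X * (Ideal.absNorm (J : Ideal (𝓞 K)) : ℝ)⁻¹)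
    rw [inv_mul_cancel_right₀ hN.ne'] at this
    rw [← this]
    push_cast
    ring
  rw [h2]
  refine (h.const_mul_left _).trans ?_
  have := (isBigO_refl (fun X : ℝ ↦ X) atTop).const_mul_left
    ((Ideal.absNorm (J : Ideal (𝓞 K)) : ℝ)⁻¹)
  refine this.congr_left fun X ↦ ?_
  simp [mul_comm]

/-- The exponent in the error term of the ideal counting estimate. -/
def countExp : ℝ := 1 - 1 / (4 * Module.finrank ℚ K)

theorem countExp_lt_one : countExp K < 1 := by
  have := finrank_pos_real K
  have : (0 : ℝ) < 1 / (4 * Module.finrank ℚ K) := by positivity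
  unfold countExp
  linarith

/-- The box estimate would allow exponent `1 - 1/(2d)`, but this is only `1/2` when `d = 1`. The
weaker `1 - 1/(4d)` stays at least `3/4`, above the value `1/2` at which the later sum over prime
squares ceases to be controlled. -/
theorem le_countExp : 3 / 4 ≤ countExp K := by
  have h := finrank_pos_real K
  have : (1 : ℝ) / (4 * Module.finrank ℚ K) ≤ 1 / 4 := by
    apply one_div_le_one_div_of_le <;> linarith
  unfold countExp
  linarith

theorem exists_conePointCount_estimate (J : (Ideal (𝓞 K))⁰) : ∃ α : ℝ,
    (fun X : ℝ ↦ (conePointCount K J X : ℝ) - α * X) =O[atTop] fun X ↦ X ^ countExp K := by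
  obtain ⟨α, C, b₀, h⟩ := exists_card_coneBox_estimate K J
  have hd1 : (1 : ℝ) ≤ Module.finrank ℚ K := finrank_pos_real K
  refine ⟨α, ?_⟩
  have h1 : (fun X : ℝ ↦ (conePointCount K J (√X) : ℝ)) =O[atTop] fun X ↦ X ^ countExp K := by
    refine ((isBigO_conePointCount K J).comp_tendsto Real.tendsto_sqrt_atTop).trans ?_
    refine IsBigO.of_bound 1 ?_
    filter_upwards [eventually_ge_atTop 1] with X hX
    rw [Function.comp_apply, Real.sqrt_eq_rpow, one_mul, Real.norm_of_nonneg (by positivity),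
      Real.norm_of_nonneg (by positivity)]
    exact Real.rpow_le_rpow_of_exponent_le hX (by linarith [le_countExp K])
  have h2 : (fun X : ℝ ↦ ((coneBox K (Real.log X / Module.finrank ℚ K / 2)
      (Real.log X / Module.finrank ℚ K) 0 ∩ latticeOf K J).ncard : ℝ) - α * X) =O[atTop]
      fun X ↦ X ^ countExp K := by
    refine IsBigO.of_bound |C| ?_
    have hlog : Tendsto (fun X : ℝ ↦ Real.log X / Module.finrank ℚ K) atTop atTop :=
      Real.tendsto_log_atTop.atTop_div_const (by positivity)
    filter_upwards [hlog.eventually_ge_atTop b₀, eventually_ge_atTop 1] with X hb hX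
    have hX0 : 0 < X := by linarith
    have h3 := h _ hb
    rw [mul_div_cancel₀ _ (by positivity), Real.exp_log hX0] at h3
    rw [Real.norm_eq_abs, Real.norm_of_nonneg (by positivity)]
    refine h3.trans ?_
    gcongr
    · exact le_abs_self C
    · rw [Real.rpow_def_of_pos hX0, Real.exp_le_exp, countExp]
      have hl := Real.log_nonneg hX
      rw [mul_div_assoc', div_le_iff₀ (by positivity)]
      field_simp
      nlinarith
  refine (h1.add h2).congr' ?_ EventuallyEq.rfl
  filter_upwards [eventually_ge_atTop 1] with X hX
  rw [conePointCount_eq_add K J hX]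
  push_cast
  ring

theorem exists_classCount_estimate (C : ClassGroup (𝓞 K)) : ∃ α : ℝ,
    (fun s : ℝ ↦ (classCount K C s : ℝ) - α * s) =O[atTop] fun s ↦ s ^ countExp K := by
  obtain ⟨J, hJ⟩ := ClassGroup.mk0_surjective C⁻¹
  obtain ⟨α, h⟩ := exists_conePointCount_estimate K J
  have hN : (0 : ℝ) < Ideal.absNorm (J : Ideal (𝓞 K)) :=
    Nat.cast_pos.mpr (Ideal.absNorm_pos_of_nonZeroDivisors J)
  have ht : (0 : ℝ) < torsionOrder K := Nat.cast_pos.mpr (torsionOrder_pos K)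
  refine ⟨α * Ideal.absNorm (J : Ideal (𝓞 K)) / torsionOrder K, ?_⟩
  have h1 := (h.comp_tendsto (tendsto_id.atTop_mul_const hN)).const_mul_left
    (torsionOrder K : ℝ)⁻¹
  have h2 : ((fun X : ℝ ↦ X ^ countExp K) ∘ fun s : ℝ ↦
      id s * (Ideal.absNorm (J : Ideal (𝓞 K)) : ℝ)) =O[atTop] fun s ↦ s ^ countExp K := by
    refine IsBigO.of_bound ((Ideal.absNorm (J : Ideal (𝓞 K)) : ℝ) ^ countExp K) ?_
    filter_upwards [eventually_ge_atTop 0] with s hs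
    rw [Function.comp_apply, id, Real.mul_rpow hs hN.le, Real.norm_of_nonneg (by positivity),
      Real.norm_of_nonneg (by positivity), mul_comm]
  refine (h1.trans h2).congr_left fun s ↦ ?_
  have h3 := classCount_mul_torsionOrder hJ s
  simp only [Function.comp_apply, id]
  rw [← h3]
  push_cast
  field_simp

/-- The number of nonzero ideals of norm at most `s`. -/
def idealCount (s : ℝ) : ℕ :=
  Nat.card {I : (Ideal (𝓞 K))⁰ // Ideal.absNorm (I : Ideal (𝓞 K)) ≤ s}

theorem idealCount_eq_sum {s : ℝ} (hs : 0 ≤ s) : idealCount K s = ∑ C, classCount K C s := by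
  have : Fintype {I : (Ideal (𝓞 K))⁰ // Ideal.absNorm (I : Ideal (𝓞 K)) ≤ s} := by
    simp_rw [← Nat.le_floor_iff hs]
    refine @Fintype.ofFinite _ (Ideal.finite_setOfPred_absNorm_le₀ ⌊s⌋₊)
  let e := fun C : ClassGroup (𝓞 K) ↦ Equiv.subtypeSubtypeEquivSubtypeInter
    (fun I : (Ideal (𝓞 K))⁰ ↦ Ideal.absNorm I.1 ≤ s) (fun I ↦ ClassGroup.mk0 I = C)
  simp_rw [classCount, ← Nat.card_congr (e _), Nat.card_eq_fintype_card, Fintype.subtype_card]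
  rw [idealCount, Nat.card_eq_fintype_card, Fintype.card,
    Finset.card_eq_sum_card_fiberwise (f := fun I ↦ ClassGroup.mk0 I.1)
    (t := Finset.univ) (fun _ _ ↦ Finset.mem_univ _)]

/-- The leading constants of the classes are never computed. Their sum is the limit of `idealCount K
s / s`, hence equals the residue by uniqueness of limits. -/
theorem isBigO_idealCount_sub :
    (fun s : ℝ ↦ (idealCount K s : ℝ) - dedekindZeta_residue K * s) =O[atTop]
      fun s ↦ s ^ countExp K := by
  choose α h using exists_classCount_estimate K
  have h1 : (fun s : ℝ ↦ (idealCount K s : ℝ) - (∑ C, α C) * s) =O[atTop]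
      fun s ↦ s ^ countExp K := by
    refine (IsBigO.fun_sum (s := Finset.univ) fun C _ ↦ h C).congr' ?_ EventuallyEq.rfl
    filter_upwards [eventually_ge_atTop 0] with s hs
    rw [Finset.sum_sub_distrib, idealCount_eq_sum K hs, Finset.sum_mul]
    push_cast
    rfl
  have h2 : Tendsto (fun s : ℝ ↦ (idealCount K s : ℝ) / s) atTop (𝓝 (∑ C, α C)) := by
    have h3 : (fun s : ℝ ↦ s ^ countExp K) =o[atTop] fun s ↦ s := by
      refine (isLittleO_iff_tendsto' ?_).2 ?_
      · filter_upwards [eventually_ne_atTop 0] with s hs h using absurd h hs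
      · refine (tendsto_rpow_neg_atTop (sub_pos.2 (countExp_lt_one K))).congr' ?_
        filter_upwards [eventually_gt_atTop 0] with s hs
        rw [neg_sub, Real.rpow_sub hs, Real.rpow_one]
    have h4 := ((h1.trans_isLittleO h3).tendsto_div_nhds_zero).add_const (∑ C, α C)
    rw [zero_add] at h4
    refine h4.congr' ?_
    filter_upwards [eventually_ne_atTop 0] with s hs
    field_simp
    ring
  have h5 := tendsto_nhds_unique h2 (NumberField.Ideal.tendsto_norm_le_div_atTop₀ K)
  rw [dedekindZeta_residue_def, ← h5]
  exact h1

theorem idealCount_mono {s t : ℝ} (h : s ≤ t) : idealCount K s ≤ idealCount K t := by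
  have : Finite {I : (Ideal (𝓞 K))⁰ // Ideal.absNorm (I : Ideal (𝓞 K)) ≤ t} := by
    by_cases ht : 0 ≤ t
    · simp_rw [← Nat.le_floor_iff ht]
      exact Ideal.finite_setOfPred_absNorm_le₀ ⌊t⌋₊
    · refine @Finite.of_subsingleton _ ⟨fun I ↦ absurd I.2 (not_le.2 ?_)⟩
      exact (not_le.1 ht).trans_le (Nat.cast_nonneg _)
  exact Nat.card_le_card_of_injective _
    (Subtype.impEmbedding _ _ fun I hI ↦ le_trans hI h).injective

theorem idealCount_eq_zero {s : ℝ} (h : s < 1) : idealCount K s = 0 := by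
  rw [idealCount, Nat.card_eq_zero]
  refine Or.inl ⟨fun ⟨I, hI⟩ ↦ ?_⟩
  have : (1 : ℝ) ≤ Ideal.absNorm (I : Ideal (𝓞 K)) :=
    Nat.one_le_cast.2 (Ideal.absNorm_pos_of_nonZeroDivisors I)
  linarith

/-- Uniformity down to `s → 0` is needed both to integrate the estimate from `0` and, later, to
include ideals of norm above `x` without treating a tail separately. -/
theorem exists_idealCount_estimate : ∃ C : ℝ, 0 < C ∧ ∀ s : ℝ, 0 < s →
    |(idealCount K s : ℝ) - dedekindZeta_residue K * s| ≤ C * s ^ countExp K := by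
  have hlam := dedekindZeta_residue_pos K
  obtain ⟨C₁, hC₁, h⟩ := (isBigO_idealCount_sub K).exists_pos
  obtain ⟨s₀, hs₀⟩ := eventually_atTop.1 h.bound
  have hexp := countExp_lt_one K
  have hexp' := le_countExp K
  -- The three summands serve `s₀ ≤ s`, the bounded range `1 ≤ s < s₀`, and `s < 1` respectively.
  refine ⟨C₁ + (idealCount K s₀ + dedekindZeta_residue K * |s₀|) + dedekindZeta_residue K,
    by positivity, fun s hs ↦ ?_⟩
  rcases lt_or_ge s 1 with h1 | h1
  · rw [idealCount_eq_zero K h1, Nat.cast_zero, zero_sub, abs_neg, abs_of_nonneg (by positivity)]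
    have h2 : s ≤ s ^ countExp K := by
      simpa using Real.rpow_le_rpow_of_exponent_ge hs h1.le hexp.le
    have : 0 ≤ C₁ + (idealCount K s₀ + dedekindZeta_residue K * |s₀|) := by positivity
    have : 0 ≤ s ^ countExp K := by positivity
    nlinarith
  · have h2 : 1 ≤ s ^ countExp K := Real.one_le_rpow h1 (by linarith)
    rcases le_or_gt s₀ s with h3 | h3
    · have h4 := hs₀ s h3
      rw [Real.norm_eq_abs, Real.norm_of_nonneg (by positivity)] at h4
      refine h4.trans ?_
      gcongr
      have : 0 ≤ idealCount K s₀ + dedekindZeta_residue K * |s₀| := by positivity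
      linarith
    · have h4 : (idealCount K s : ℝ) ≤ idealCount K s₀ := Nat.cast_le.2 (idealCount_mono K h3.le)
      have h5 : dedekindZeta_residue K * s ≤ dedekindZeta_residue K * |s₀| := by
        gcongr
        exact h3.le.trans (le_abs_self _)
      have h6 : |(idealCount K s : ℝ) - dedekindZeta_residue K * s| ≤
          idealCount K s₀ + dedekindZeta_residue K * |s₀| := by
        have h7 : (0 : ℝ) ≤ idealCount K s := Nat.cast_nonneg _
        have h8 : (0 : ℝ) ≤ dedekindZeta_residue K * s := by positivity
        rw [abs_le]
        constructor <;> linarith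
      refine h6.trans ?_
      have : (idealCount K s₀ + dedekindZeta_residue K * |s₀|) * 1 ≤
        (C₁ + (idealCount K s₀ + dedekindZeta_residue K * |s₀|) + dedekindZeta_residue K) *
          s ^ countExp K := by
        refine mul_le_mul ?_ h2 zero_le_one (by positivity)
        linarith
      linarith

end IdealCount

/-! ### Euler products over finitely supported exponents, and partial summation -/

section FinsuppProducts

open Filter Topology

variable {ι : Type*}

theorem sum_finsupp_prod_eq_prod_sum {R M : Type*} [CommSemiring R] [AddCommMonoid M]
    (s : Finset ι) (t : ι → Finset M) (g : ι → M → R) :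
    ∑ a ∈ s.finsupp t, ∏ i ∈ s, g i (a i) = ∏ i ∈ s, ∑ n ∈ t i, g i n := by
  classical
  rw [Finset.prod_sum, Finset.finsupp, Finset.sum_map]
  refine Finset.sum_congr (by congr!) fun p _ ↦ ?_
  rw [← Finset.prod_attach]
  refine Finset.prod_congr rfl fun i _ ↦ ?_
  simp [Finsupp.indicator_of_mem i.2]

theorem sum_box_prod {R : Type*} [CommSemiring R] (s : Finset ι) (t : ι → Finset ℕ)
    {g : ι → ℕ → R} (hg : ∀ i, g i 0 = 1) :
    ∑ a ∈ s.finsupp t, a.prod g = ∏ i ∈ s, ∑ n ∈ t i, g i n := by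
  rw [← sum_finsupp_prod_eq_prod_sum]
  refine Finset.sum_congr rfl fun a ha ↦ ?_
  exact Finsupp.prod_of_support_subset _ (Finset.mem_finsupp_iff.1 ha).1 _ fun i _ ↦ hg i

/-- The box of finitely supported functions supported in `s` with values at most `N`. -/
def finsuppBox (p : Finset ι × ℕ) : Finset (ι →₀ ℕ) :=
  p.1.finsupp fun _ ↦ Finset.range (p.2 + 1)

theorem mem_finsuppBox {p : Finset ι × ℕ} {a : ι →₀ ℕ} :
    a ∈ finsuppBox p ↔ a.support ⊆ p.1 ∧ ∀ i, a i ≤ p.2 := by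
  rw [finsuppBox, Finset.mem_finsupp_iff]
  simp only [Finset.mem_range, Nat.lt_succ_iff]
  refine and_congr_right fun h ↦ ⟨fun h' i ↦ ?_, fun h' i _ ↦ h' i⟩
  by_cases hi : i ∈ a.support
  · exact h' i (h hi)
  · rw [Finsupp.notMem_support_iff.1 hi]
    exact Nat.zero_le _

theorem tendsto_finsuppBox :
    Tendsto (finsuppBox (ι := ι)) atTop atTop := by
  refine tendsto_atTop_finset_of_monotone (fun p q hpq a ha ↦ ?_) fun a ↦
    ⟨(a.support, a.support.sup a), mem_finsuppBox.2 ⟨subset_rfl, fun i ↦ ?_⟩⟩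
  · rw [mem_finsuppBox] at ha ⊢
    exact ⟨ha.1.trans hpq.1, fun i ↦ (ha.2 i).trans hpq.2⟩
  · by_cases hi : i ∈ a.support
    · exact Finset.le_sup (f := a) hi
    · rw [Finsupp.notMem_support_iff.1 hi]
      exact Nat.zero_le _

theorem sum_range_succ_le_exp {u : ℕ → ℝ} (h0 : u 0 = 1) (hu : ∀ n, 0 ≤ u n)
    (hs : Summable fun n ↦ u (n + 1)) (N : ℕ) :
    ∑ n ∈ Finset.range (N + 1), u n ≤ Real.exp (∑' n, u (n + 1)) := by
  rw [Finset.sum_range_succ', h0]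
  exact (add_le_add_left (hs.sum_le_tsum _ fun n _ ↦ hu _) 1).trans (Real.add_one_le_exp _)

theorem summable_finsupp_prod {g : ι → ℕ → ℝ} (h0 : ∀ i, g i 0 = 1) (hg : ∀ i n, 0 ≤ g i n)
    (hs : Summable fun p : ι × ℕ ↦ g p.1 (p.2 + 1)) : Summable fun a : ι →₀ ℕ ↦ a.prod g := by
  classical
  have hfib := fun i ↦ hs.prod_factor i
  refine summable_of_sum_le (c := Real.exp (∑' i, ∑' n, g i (n + 1)))
    (fun a ↦ Finset.prod_nonneg fun i _ ↦ hg i _) fun A ↦ ?_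
  obtain ⟨p, hp⟩ := (tendsto_finsuppBox.eventually_ge_atTop A).exists
  calc ∑ a ∈ A, a.prod g ≤ ∑ a ∈ finsuppBox p, a.prod g :=
        Finset.sum_le_sum_of_subset_of_nonneg hp fun a _ _ ↦
          Finset.prod_nonneg fun i _ ↦ hg i _
    _ = ∏ i ∈ p.1, ∑ n ∈ Finset.range (p.2 + 1), g i n := sum_box_prod _ _ h0
    _ ≤ ∏ i ∈ p.1, Real.exp (∑' n, g i (n + 1)) :=
        Finset.prod_le_prod (fun i _ ↦ Finset.sum_nonneg fun n _ ↦ hg i n) fun i _ ↦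
          sum_range_succ_le_exp (h0 i) (hg i) (hfib i) _
    _ = Real.exp (∑ i ∈ p.1, ∑' n, g i (n + 1)) := (Real.exp_sum _ _).symm
    _ ≤ _ := Real.exp_le_exp.2 (hs.prod.sum_le_tsum _ fun i _ ↦ tsum_nonneg fun n ↦ hg i _)

/-- The Euler product principle: finite boxes of exponents exhaust all exponent vectors, and the sum
over a box factors as a finite product. -/
theorem hasSum_finsupp_prod {g : ι → ℕ → ℝ} (h0 : ∀ i, g i 0 = 1)
    (hs : Summable fun p : ι × ℕ ↦ |g p.1 (p.2 + 1)|) :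
    (∀ i, Summable (g i)) ∧ HasProd (fun i ↦ ∑' n, g i n) (∑' a : ι →₀ ℕ, a.prod g) ∧
      Multipliable (fun i ↦ ∑' n, g i n) ∧ Summable fun a : ι →₀ ℕ ↦ a.prod g := by
  classical
  have hfib := fun i ↦ hs.prod_factor i
  have hsum : ∀ i, Summable (g i) := fun i ↦ (summable_nat_add_iff 1).1 (hfib i).of_abs
  have habs : Summable fun a : ι →₀ ℕ ↦ a.prod g := by
    refine Summable.of_abs ?_
    refine (summable_finsupp_prod (g := fun i n ↦ |g i n|) (fun i ↦ by simp [h0])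
      (fun i n ↦ abs_nonneg _) hs).congr fun a ↦ ?_
    simp only [Finsupp.prod, Finset.abs_prod]
  have hmul : Multipliable fun i ↦ ∑' n, g i n := by
    have h1 : Summable fun i ↦ ‖∑' n, g i (n + 1)‖ :=
      hs.prod.of_nonneg_of_le (fun i ↦ norm_nonneg _) fun i ↦ norm_tsum_le_tsum_norm (hfib i)
    refine (multipliable_one_add_of_summable h1).congr fun i ↦ ?_
    rw [(hsum i).tsum_eq_zero_add, h0]
  refine ⟨hsum, ?_, hmul, habs⟩
  have hT : Tendsto (fun p : Finset ι × ℕ ↦ ∏ i ∈ p.1, ∑ n ∈ Finset.range (p.2 + 1), g i n) atTop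
      (𝓝 (∑' a : ι →₀ ℕ, a.prod g)) := by
    refine (habs.hasSum.comp tendsto_finsuppBox).congr fun p ↦ ?_
    exact sum_box_prod _ _ h0
  have hinner : ∀ s : Finset ι, Tendsto (fun N : ℕ ↦ ∏ i ∈ s, ∑ n ∈ Finset.range (N + 1), g i n)
      atTop (𝓝 (∏ i ∈ s, ∑' n, g i n)) := fun s ↦
    tendsto_finsetProd _ fun i _ ↦ ((hsum i).tendsto_sum_tsum_nat).comp (tendsto_add_atTop_nat 1)
  rw [HasProd, SummationFilter.unconditional_filter, Metric.tendsto_atTop]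
  intro ε hε
  -- The box limit is joint in the set of indices and the exponent bound, so for fixed `s ⊇ s₀` the
  -- exponent bound can go to infinity, keeping distance at most `ε / 2`.
  obtain ⟨⟨s₀, N₀⟩, h⟩ := Metric.tendsto_atTop.1 hT (ε / 2) (by positivity)
  refine ⟨s₀, fun s hs' ↦ lt_of_le_of_lt ?_ (half_lt_self hε)⟩
  refine le_of_tendsto ((hinner s).dist tendsto_const_nhds) ?_
  filter_upwards [eventually_ge_atTop N₀] with N hN
  exact (h (s, N) ⟨hs', hN⟩).le

/-- Partial summation through `∫₀^y #{n i ≤ t} dt = y * #S - ∑ n i`. The boundary term and the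
integral each contribute `C * y ^ (1 + θ)`, whence the `2`. -/
theorem abs_sum_sub_le {n : ι → ℝ} {S : Finset ι} {y lam C θ : ℝ} (hy : 0 < y) (hC : 0 ≤ C)
    (hθ : 0 ≤ θ) (hS : ∀ i ∈ S, 0 < n i ∧ n i ≤ y)
    (h : ∀ t, 0 < t → t ≤ y → |((S.filter fun i ↦ n i ≤ t).card : ℝ) - lam * t| ≤ C * t ^ θ) :
    |∑ i ∈ S, n i - lam * y ^ 2 / 2| ≤ 2 * C * y ^ (1 + θ) := by
  classical
  have hint : ∀ i, IntervalIntegrable (fun t ↦ if n i ≤ t then (1 : ℝ) else 0)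
      MeasureTheory.volume 0 y := fun i ↦ by
    refine Monotone.intervalIntegrable fun a b hab ↦ ?_
    split_ifs with h1 h2 <;> first | exact absurd (h1.trans hab) h2 | norm_num
  have hone : ∀ i ∈ S, ∫ t in (0 : ℝ)..y, (if n i ≤ t then (1 : ℝ) else 0) = y - n i := by
    intro i hi
    obtain ⟨h1, h2⟩ := hS i hi
    rw [← intervalIntegral.integral_add_adjacent_intervals (b := n i)
      ((hint i).mono_set (Set.uIcc_subset_uIcc Set.left_mem_uIcc
        (Set.mem_uIcc.2 (Or.inl ⟨h1.le, h2⟩))))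
      ((hint i).mono_set (Set.uIcc_subset_uIcc
        (Set.mem_uIcc.2 (Or.inl ⟨h1.le, h2⟩)) Set.right_mem_uIcc))]
    have e1 : ∫ t in (0 : ℝ)..n i, (if n i ≤ t then (1 : ℝ) else 0) = 0 := by
      rw [intervalIntegral.integral_of_le h1.le, MeasureTheory.integral_Ioc_eq_integral_Ioo]
      refine MeasureTheory.setIntegral_eq_zero_of_forall_eq_zero fun t ht ↦ ?_
      rw [if_neg (not_le.2 ht.2)]
    have e2 : ∫ t in n i..y, (if n i ≤ t then (1 : ℝ) else 0) = y - n i := by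
      have : ∫ t in n i..y, (if n i ≤ t then (1 : ℝ) else 0) = ∫ t in n i..y, (1 : ℝ) := by
        refine intervalIntegral.integral_congr fun t ht ↦ ?_
        rw [Set.uIcc_of_le h2] at ht
        exact if_pos ht.1
      rw [this, intervalIntegral.integral_const]
      simp
    rw [e1, e2, zero_add]
  have hcard : ∀ t, ((S.filter fun i ↦ n i ≤ t).card : ℝ) =
      ∑ i ∈ S, if n i ≤ t then (1 : ℝ) else 0 := fun t ↦ by
    rw [Finset.sum_boole]
  have hsumint : ∫ t in (0 : ℝ)..y, (((S.filter fun i ↦ n i ≤ t).card : ℝ) - lam * t) =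
      S.card * y - ∑ i ∈ S, n i - lam * y ^ 2 / 2 := by
    simp_rw [hcard]
    rw [intervalIntegral.integral_sub, intervalIntegral.integral_finsetSum fun i _ ↦ hint i,
      Finset.sum_congr rfl hone, Finset.sum_sub_distrib, intervalIntegral.integral_const_mul,
      integral_id]
    · simp
      ring
    · have := IntervalIntegrable.sum S (f := fun i t ↦ if n i ≤ t then (1 : ℝ) else 0)
        fun i _ ↦ hint i
      refine this.congr fun t _ ↦ ?_
      simp
    · exact (continuous_const.mul continuous_id).intervalIntegrable _ _
  have hbound : |∫ t in (0 : ℝ)..y, (((S.filter fun i ↦ n i ≤ t).card : ℝ) - lam * t)| ≤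
      C * y ^ θ * |y - 0| := by
    rw [← Real.norm_eq_abs]
    refine intervalIntegral.norm_integral_le_of_norm_le_const fun t ht ↦ ?_
    rw [Set.uIoc_of_le hy.le] at ht
    refine (h t ht.1 ht.2).trans ?_
    have := ht.1.le
    have := ht.2
    gcongr
  have hy' := h y hy le_rfl
  rw [Finset.filter_true_of_mem fun i hi ↦ (hS i hi).2] at hy'
  rw [hsumint, sub_zero, abs_of_pos hy] at hbound
  have hpow : y ^ (1 + θ) = y * y ^ θ := by rw [Real.rpow_add hy, Real.rpow_one]
  rw [hpow]
  have e : ∑ i ∈ S, n i - lam * y ^ 2 / 2 =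
      (S.card - lam * y) * y - (S.card * y - ∑ i ∈ S, n i - lam * y ^ 2 / 2) := by ring
  rw [e]
  refine (abs_sub _ _).trans ?_
  rw [abs_mul, abs_of_pos hy]
  have := mul_le_mul_of_nonneg_right hy' hy.le
  linarith

end FinsuppProducts

/-! ### Ideals as exponent vectors, and convolution with the norm -/

section IdealFactorization

open UniqueFactorizationMonoid
open scoped Classical nonZeroDivisors

variable {K : Type*} [Field K]

/-- The ideal with prescribed prime factorization. -/
def idealOf (a : HeightOneSpectrum (𝓞 K) →₀ ℕ) : Ideal (𝓞 K) :=
  a.prod fun v n ↦ v.asIdeal ^ n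

theorem idealOf_add (a b : HeightOneSpectrum (𝓞 K) →₀ ℕ) :
    idealOf (a + b) = idealOf a * idealOf b :=
  Finsupp.prod_add_index' (fun _ ↦ pow_zero _) fun _ _ _ ↦ pow_add _ _ _

theorem idealOf_single (v : HeightOneSpectrum (𝓞 K)) (n : ℕ) :
    idealOf (Finsupp.single v n) = v.asIdeal ^ n :=
  Finsupp.prod_single_index (pow_zero _)

theorem idealOf_ne_zero (a : HeightOneSpectrum (𝓞 K) →₀ ℕ) : idealOf a ≠ 0 :=
  Finset.prod_ne_zero_iff.2 fun v _ ↦ pow_ne_zero _ v.ne_bot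

variable [NumberField K]

/-- The norm of a nonzero prime ideal. -/
def primeNorm (v : HeightOneSpectrum (𝓞 K)) : ℝ := Ideal.absNorm v.asIdeal

theorem two_le_primeNorm (v : HeightOneSpectrum (𝓞 K)) : 2 ≤ primeNorm v := by
  have h0 : Ideal.absNorm v.asIdeal ≠ 0 := by
    rw [Ne, Ideal.absNorm_eq_zero_iff]
    exact v.ne_bot
  have h1 : Ideal.absNorm v.asIdeal ≠ 1 := by
    rw [Ne, Ideal.absNorm_eq_one_iff]
    exact v.isPrime.ne_top
  have : 2 ≤ Ideal.absNorm v.asIdeal := by omega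
  rw [primeNorm]
  exact_mod_cast this

theorem primeNorm_pos (v : HeightOneSpectrum (𝓞 K)) : 0 < primeNorm v := by
  linarith [two_le_primeNorm v]

/-- The norm of the ideal with prescribed prime factorization. -/
def normOf (a : HeightOneSpectrum (𝓞 K) →₀ ℕ) : ℝ :=
  a.prod fun v n ↦ primeNorm v ^ n

theorem normOf_add (a b : HeightOneSpectrum (𝓞 K) →₀ ℕ) :
    normOf (a + b) = normOf a * normOf b :=
  Finsupp.prod_add_index' (fun _ ↦ pow_zero _) fun _ _ _ ↦ pow_add _ _ _

theorem absNorm_idealOf (a : HeightOneSpectrum (𝓞 K) →₀ ℕ) :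
    (Ideal.absNorm (idealOf a) : ℝ) = normOf a := by
  simp only [idealOf, normOf, Finsupp.prod, map_prod, map_pow, Nat.cast_prod, Nat.cast_pow,
    primeNorm]

theorem one_le_normOf (a : HeightOneSpectrum (𝓞 K) →₀ ℕ) : 1 ≤ normOf a := by
  rw [← absNorm_idealOf, Nat.one_le_cast, Nat.one_le_iff_ne_zero, Ne, Ideal.absNorm_eq_zero_iff]
  exact idealOf_ne_zero a

theorem normOf_pos (a : HeightOneSpectrum (𝓞 K) →₀ ℕ) : 0 < normOf a :=
  zero_lt_one.trans_le (one_le_normOf a)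

theorem count_normalizedFactors_idealOf (a : HeightOneSpectrum (𝓞 K) →₀ ℕ)
    (v : HeightOneSpectrum (𝓞 K)) :
    (normalizedFactors (idealOf a)).count v.asIdeal = a v := by
  induction a using Finsupp.induction_linear with
  | zero =>
    rw [show idealOf (0 : HeightOneSpectrum (𝓞 K) →₀ ℕ) = 1 from rfl, normalizedFactors_one]
    simp
  | add a b ha hb =>
    rw [idealOf_add, normalizedFactors_mul (idealOf_ne_zero a) (idealOf_ne_zero b),
      Multiset.count_add, ha, hb, Finsupp.add_apply]
  | single w n =>
    rw [idealOf_single, normalizedFactors_pow, normalizedFactors_irreducible w.irreducible,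
      normalize_eq, Multiset.count_nsmul, Multiset.count_singleton, Finsupp.single_apply]
    have : v.asIdeal = w.asIdeal ↔ w = v := by
      rw [HeightOneSpectrum.ext_iff, eq_comm]
    simp only [this]
    split_ifs <;> simp

theorem idealOf_injective : Function.Injective (idealOf (K := K)) := fun a b h ↦ by
  ext v
  rw [← count_normalizedFactors_idealOf, h, count_normalizedFactors_idealOf]

theorem exists_idealOf_eq (I : Ideal (𝓞 K)) (hI : I ≠ 0) : ∃ a, idealOf a = I := by
  induction I using induction_on_prime with
  | h₁ => exact absurd rfl hI
  | h₂ x hx => exact ⟨0, by rw [isUnit_iff_eq_one.1 hx]; rfl⟩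
  | h₃ J p hJ hp ih =>
    obtain ⟨a, ha⟩ := ih hJ
    exact ⟨Finsupp.single ⟨p, Ideal.isPrime_of_prime hp, hp.ne_zero⟩ 1 + a, by
      rw [idealOf_add, idealOf_single, ha, pow_one]⟩

variable (K) in
/-- Nonzero ideals correspond to finitely supported functions on the nonzero primes. -/
def idealEquiv : (HeightOneSpectrum (𝓞 K) →₀ ℕ) ≃ (Ideal (𝓞 K))⁰ :=
  Equiv.ofBijective (fun a ↦ ⟨idealOf a, mem_nonZeroDivisors_of_ne_zero (idealOf_ne_zero a)⟩)
    ⟨fun a b h ↦ idealOf_injective (congrArg Subtype.val h), fun I ↦ by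
      obtain ⟨a, ha⟩ := exists_idealOf_eq I.1 (nonZeroDivisors.coe_ne_zero I)
      exact ⟨a, Subtype.ext ha⟩⟩

theorem irrationalFactor_idealOf (k : ℕ) (a : HeightOneSpectrum (𝓞 K) →₀ ℕ) :
    irrationalFactor K k (idealOf a) = a.prod fun v n ↦ primeNorm v ^ beta k n := by
  rw [irrationalFactor]
  have himg : (normalizedFactors (idealOf a)).toFinset = a.support.image fun v ↦ v.asIdeal := by
    ext p
    simp only [Multiset.mem_toFinset, Finset.mem_image, Finsupp.mem_support_iff]
    constructor
    · intro hp
      have hp' := prime_of_normalized_factor p hp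
      refine ⟨⟨p, Ideal.isPrime_of_prime hp', hp'.ne_zero⟩, ?_, rfl⟩
      rw [← count_normalizedFactors_idealOf]
      exact (Multiset.count_pos.2 hp).ne'
    · rintro ⟨v, hv, rfl⟩
      rw [← count_normalizedFactors_idealOf] at hv
      exact Multiset.count_pos.1 (Nat.pos_of_ne_zero hv)
  rw [himg, Finset.prod_image fun v _ w _ h ↦ HeightOneSpectrum.ext h]
  refine Finset.prod_congr rfl fun v _ ↦ ?_
  rw [count_normalizedFactors_idealOf]
  rfl

theorem finite_normOf_le (x : ℝ) : {a : HeightOneSpectrum (𝓞 K) →₀ ℕ | normOf a ≤ x}.Finite := by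
  refine Set.Finite.of_finite_image ((finite_ideals_absNorm_le K x).subset ?_)
    idealOf_injective.injOn
  rintro _ ⟨a, ha, rfl⟩
  exact ⟨idealOf_ne_zero a, (absNorm_idealOf a).trans_le ha⟩

variable (K) in
/-- The factorizations of the ideals of norm at most `x`. -/
def normBall (x : ℝ) : Finset (HeightOneSpectrum (𝓞 K) →₀ ℕ) := (finite_normOf_le x).toFinset

theorem mem_normBall {x : ℝ} {a : HeightOneSpectrum (𝓞 K) →₀ ℕ} :
    a ∈ normBall K x ↔ normOf a ≤ x := by
  simp [normBall]

theorem irrationalFactorSum_eq (k : ℕ) (x : ℝ) : irrationalFactorSum K k x =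
    ∑ a ∈ normBall K x, a.prod fun v n ↦ primeNorm v ^ beta k n := by
  rw [irrationalFactorSum]
  symm
  refine Finset.sum_bij (fun a _ ↦ idealOf a) (fun a ha ↦ ?_)
    (fun a _ b _ h ↦ idealOf_injective h) (fun I hI ↦ ?_)
    (fun a _ ↦ (irrationalFactor_idealOf k a).symm)
  · simp only [Set.Finite.mem_toFinset, Set.mem_ofPred_eq]
    exact ⟨idealOf_ne_zero a, (absNorm_idealOf a).trans_le (mem_normBall.1 ha)⟩
  · simp only [Set.Finite.mem_toFinset, Set.mem_ofPred_eq] at hI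
    obtain ⟨a, rfl⟩ := exists_idealOf_eq I hI.1
    exact ⟨a, mem_normBall.2 ((absNorm_idealOf a).symm.trans_le hI.2), rfl⟩

theorem card_normBall (x : ℝ) : (normBall K x).card = idealCount K x := by
  rw [idealCount, normBall, ← Nat.card_eq_card_finite_toFinset]
  refine Nat.card_congr ((idealEquiv K).subtypeEquiv fun a ↦ ?_)
  change normOf a ≤ x ↔ (Ideal.absNorm (idealOf a) : ℝ) ≤ x
  rw [absNorm_idealOf]

/-- The sum of the norms of the ideals of norm at most `y`. -/
def normSum (K : Type*) [Field K] [NumberField K] (y : ℝ) : ℝ := ∑ a ∈ normBall K y, normOf a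

variable (K) in
theorem exists_normSum_estimate : ∃ C : ℝ, 0 < C ∧ ∀ y : ℝ, 0 < y →
    |normSum K y - dedekindZeta_residue K * y ^ 2 / 2| ≤ C * y ^ (1 + countExp K) := by
  obtain ⟨C, hC, h⟩ := exists_idealCount_estimate K
  refine ⟨2 * C, by positivity, fun y hy ↦ ?_⟩
  refine abs_sum_sub_le hy hC.le (by linarith [le_countExp K])
    (fun a ha ↦ ⟨normOf_pos a, mem_normBall.1 ha⟩) fun t ht hty ↦ ?_
  have : (normBall K y).filter (fun a ↦ normOf a ≤ t) = normBall K t := by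
    ext a
    rw [Finset.mem_filter, mem_normBall, mem_normBall]
    exact ⟨fun h ↦ h.2, fun h ↦ ⟨h.trans hty, h⟩⟩
  rw [this, card_normBall]
  exact h t ht

/-- Convolution identity between multiplicative functions, given locally. -/
theorem prod_eq_sum_box {f h : HeightOneSpectrum (𝓞 K) → ℕ → ℝ}
    (hloc : ∀ v n, ∑ j ∈ Finset.range (n + 1), h v j * primeNorm v ^ (n - j) = f v n)
    (h0 : ∀ v, h v 0 = 1) (c : HeightOneSpectrum (𝓞 K) →₀ ℕ) :
    c.prod f = ∑ a ∈ Finset.Iic c, a.prod h * normOf (c - a) := by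
  -- The divisors of `c` form a box, so the product of the local convolution sums expands into a sum
  -- over divisors.
  have hbox : Finset.Iic c = c.support.finsupp fun v ↦ Finset.range (c v + 1) := by
    ext a
    rw [Finset.mem_Iic, Finset.mem_finsupp_iff]
    simp only [Finset.mem_range, Nat.lt_succ_iff]
    refine ⟨fun h ↦ ⟨Finsupp.support_mono h, fun v _ ↦ h v⟩, fun h v ↦ ?_⟩
    by_cases hv : v ∈ c.support
    · exact h.2 v hv
    · rw [Finsupp.notMem_support_iff.1 fun hv' ↦ hv (h.1 hv')]
      exact Nat.zero_le _
  calc c.prod f = ∏ v ∈ c.support, ∑ j ∈ Finset.range (c v + 1),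
        h v j * primeNorm v ^ (c v - j) := Finset.prod_congr rfl fun v _ ↦ (hloc v _).symm
    _ = ∑ a ∈ Finset.Iic c, ∏ v ∈ c.support, h v (a v) * primeNorm v ^ (c v - a v) := by
        rw [hbox]
        exact (sum_finsupp_prod_eq_prod_sum _ _
          fun v j ↦ h v j * primeNorm v ^ (c v - j)).symm
    _ = _ := by
        refine Finset.sum_congr rfl fun a ha ↦ ?_
        rw [Finset.mem_Iic] at ha
        rw [Finset.prod_mul_distrib, Finsupp.prod_of_support_subset a (Finsupp.support_mono ha) _
          fun v _ ↦ h0 v, normOf, Finsupp.prod_of_support_subset (c - a)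
          (Finsupp.support_mono tsub_le_self) _ fun v _ ↦ pow_zero _]
        rfl

/-- Summing the convolution and exchanging the order, via `(c, a) ↦ (a, c - a)`, collects for each
`a` the cofactors of norm at most `x / normOf a`. -/
theorem sum_prod_eq_sum_normSum {f h : HeightOneSpectrum (𝓞 K) → ℕ → ℝ}
    (hloc : ∀ v n, ∑ j ∈ Finset.range (n + 1), h v j * primeNorm v ^ (n - j) = f v n)
    (h0 : ∀ v, h v 0 = 1) (x : ℝ) :
    ∑ c ∈ normBall K x, c.prod f =
      ∑ a ∈ normBall K x, a.prod h * normSum K (x / normOf a) := by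
  simp_rw [prod_eq_sum_box hloc h0, normSum, Finset.mul_sum]
  rw [Finset.sum_sigma', Finset.sum_sigma']
  refine Finset.sum_bij' (fun p _ ↦ ⟨p.2, p.1 - p.2⟩) (fun p _ ↦ ⟨p.1 + p.2, p.1⟩) ?_ ?_ ?_ ?_ ?_
  · rintro ⟨c, a⟩ hp
    simp only [Finset.mem_sigma, mem_normBall, Finset.mem_Iic] at hp ⊢
    have e : normOf a * normOf (c - a) = normOf c := by
      rw [← normOf_add, add_tsub_cancel_of_le hp.2]
    have h1 := normOf_pos a
    have h2 := one_le_normOf (c - a)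
    constructor
    · nlinarith
    · rw [le_div_iff₀ h1]
      nlinarith
  · rintro ⟨a, b⟩ hp
    simp only [Finset.mem_sigma, mem_normBall, Finset.mem_Iic] at hp ⊢
    rw [normOf_add]
    have h1 := hp.2
    rw [le_div_iff₀ (normOf_pos a)] at h1
    exact ⟨by linarith, le_self_add⟩
  · rintro ⟨c, a⟩ hp
    simp only [Finset.mem_sigma, mem_normBall, Finset.mem_Iic] at hp
    simp only [add_tsub_cancel_of_le hp.2]
  · rintro ⟨a, b⟩ hp
    simp
  · rintro ⟨c, a⟩ hp
    rfl

end IdealFactorization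

/-! ### The Dedekind zeta function as a sum and as an Euler product -/

section EulerProducts

open Filter Topology Asymptotics
open scoped nonZeroDivisors

variable (K : Type*) [Field K] [NumberField K]

theorem sum_card_absNorm_eq (n : ℕ) :
    ∑ m ∈ Finset.Icc 1 n, Nat.card {I : Ideal (𝓞 K) // Ideal.absNorm I = m} = idealCount K n := by
  simp only [idealCount, Nat.cast_le]
  rw [← add_left_inj 1, ← Ideal.card_norm_le_eq_card_norm_le_add_one,
    show Finset.Icc 1 n = Finset.Ioc 0 n from Finset.Icc_succ_left_eq_Ioc _ _,
    -- The discrepancy of one is the zero ideal, the only ideal of norm `0`.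
    show 1 = Nat.card {I : Ideal (𝓞 K) // Ideal.absNorm I = 0} by
      simp [Ideal.absNorm_eq_zero_iff],
    Finset.sum_Ioc_add_eq_sum_Icc (n.zero_le),
    ← Finset.card_preimage_eq_sum_card_image_eq (fun k _ ↦ Ideal.finite_setOfPred_absNorm_eq k)]
  simp [Set.coe_eq_subtype]

theorem lseries_term_eq {s : ℝ} (hs : s ≠ 0) (n : ℕ) :
    LSeries.term (fun n ↦ (Nat.card {I : Ideal (𝓞 K) // Ideal.absNorm I = n} : ℂ)) s n =
      ((Nat.card {I : Ideal (𝓞 K) // Ideal.absNorm I = n} * (n : ℝ) ^ (-s) : ℝ) : ℂ) := by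
  rcases eq_or_ne n 0 with rfl | hn
  · simp [Real.zero_rpow (neg_ne_zero.2 hs)]
  · rw [LSeries.term_of_ne_zero hn, Real.rpow_neg (Nat.cast_nonneg n)]
    push_cast
    rw [Complex.ofReal_cpow (Nat.cast_nonneg n), div_eq_mul_inv]
    simp

theorem summable_card_mul_rpow {s : ℝ} (hs : 1 < s) :
    Summable fun n : ℕ ↦
      (Nat.card {I : Ideal (𝓞 K) // Ideal.absNorm I = n} : ℝ) * (n : ℝ) ^ (-s) := by
  have h : LSeriesSummable
      (fun n ↦ (Nat.card {I : Ideal (𝓞 K) // Ideal.absNorm I = n} : ℂ)) (s : ℂ) := by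
    refine LSeriesSummable_of_sum_norm_bigO (r := 1) ?_ zero_le_one (by simpa using hs)
    simp only [Complex.norm_natCast, Real.rpow_one, ← Nat.cast_sum, sum_card_absNorm_eq]
    have h1 := ((NumberField.Ideal.tendsto_norm_le_div_atTop₀ K).isBigO_one ℝ).mul
      (isBigO_refl (fun s : ℝ ↦ s) atTop)
    refine (h1.comp_tendsto tendsto_natCast_atTop_atTop).congr' ?_ ?_
    · filter_upwards [eventually_ne_atTop 0] with n hn
      simp only [Function.comp_apply]
      rw [div_mul_cancel₀ _ (Nat.cast_ne_zero.2 hn), idealCount]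
    · filter_upwards with n
      simp
  refine Complex.summable_ofReal.1 (h.congr fun n ↦ ?_)
  exact lseries_term_eq K (by positivity) n

theorem hasSum_absNorm_rpow {s : ℝ} (hs : 1 < s) :
    HasSum (fun I : Ideal (𝓞 K) ↦ (Ideal.absNorm I : ℝ) ^ (-s))
      (∑' n : ℕ, (Nat.card {I : Ideal (𝓞 K) // Ideal.absNorm I = n} : ℝ) * (n : ℝ) ^ (-s)) := by
  let e := Equiv.sigmaFiberEquiv fun I : Ideal (𝓞 K) ↦ Ideal.absNorm I
  have hfin : ∀ n, Finite {I : Ideal (𝓞 K) // Ideal.absNorm I = n} := fun n ↦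
    Ideal.finite_setOfPred_absNorm_eq n
  have hfib : ∀ n : ℕ, HasSum (fun I : {I : Ideal (𝓞 K) // Ideal.absNorm I = n} ↦
      (Ideal.absNorm (e ⟨n, I⟩) : ℝ) ^ (-s))
      ((Nat.card {I : Ideal (𝓞 K) // Ideal.absNorm I = n} : ℝ) * (n : ℝ) ^ (-s)) := fun n ↦ by
    have := Fintype.ofFinite {I : Ideal (𝓞 K) // Ideal.absNorm I = n}
    have h : (fun I : {I : Ideal (𝓞 K) // Ideal.absNorm I = n} ↦
      (Ideal.absNorm (e ⟨n, I⟩) : ℝ) ^ (-s)) = fun _ ↦ (n : ℝ) ^ (-s) := by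
      ext I
      change (Ideal.absNorm I.1 : ℝ) ^ (-s) = _
      rw [I.2]
    rw [h]
    convert! hasSum_fintype (fun _ : {I : Ideal (𝓞 K) // Ideal.absNorm I = n} ↦ (n : ℝ) ^ (-s))
    rw [Finset.sum_const, Finset.card_univ, Nat.card_eq_fintype_card, nsmul_eq_mul]
  have hsum := summable_card_mul_rpow K hs
  have h1 : Summable fun p ↦ (Ideal.absNorm (e p) : ℝ) ^ (-s) := by
    refine (summable_sigma_of_nonneg fun p ↦ by positivity).2 ⟨fun n ↦ (hfib n).summable, ?_⟩
    exact hsum.congr fun n ↦ ((hfib n).tsum_eq).symm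
  exact e.hasSum_iff.1 (HasSum.sigma_of_hasSum hsum.hasSum hfib h1)

variable {K}

theorem summable_primeNorm_rpow {s : ℝ} (hs : 1 < s) :
    Summable fun v : HeightOneSpectrum (𝓞 K) ↦ primeNorm v ^ (-s) :=
  (hasSum_absNorm_rpow K hs).summable.comp_injective
    (i := fun v : HeightOneSpectrum (𝓞 K) ↦ v.asIdeal) fun _ _ h ↦ HeightOneSpectrum.ext h

theorem hasSum_normOf_rpow {s : ℝ} (hs : 1 < s) :
    HasSum (fun a : HeightOneSpectrum (𝓞 K) →₀ ℕ ↦ normOf a ^ (-s))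
      (∑' n : ℕ, (Nat.card {I : Ideal (𝓞 K) // Ideal.absNorm I = n} : ℝ) * (n : ℝ) ^ (-s)) := by
  have h := (idealOf_injective (K := K)).hasSum_iff
    (f := fun I : Ideal (𝓞 K) ↦ (Ideal.absNorm I : ℝ) ^ (-s))
    (a := ∑' n : ℕ, (Nat.card {I : Ideal (𝓞 K) // Ideal.absNorm I = n} : ℝ) * (n : ℝ) ^ (-s))
    fun I hI ↦ ?_
  · have h2 := h.2 (hasSum_absNorm_rpow K hs)
    simpa only [Function.comp_def, absNorm_idealOf] using h2
  · have : I = 0 := by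
      by_contra h0
      exact hI (exists_idealOf_eq I h0)
    rw [this]
    simp [Real.zero_rpow (by linarith : -s ≠ 0)]

theorem dedekindZeta_eq_tsum_normOf {s : ℝ} (hs : 1 < s) :
    dedekindZeta K s = ((∑' a : HeightOneSpectrum (𝓞 K) →₀ ℕ, normOf a ^ (-s) : ℝ) : ℂ) := by
  rw [dedekindZeta, LSeries, (hasSum_normOf_rpow hs).tsum_eq, Complex.ofReal_tsum]
  exact tsum_congr fun n ↦ lseries_term_eq K (by positivity) n

/-- A decay condition on local factors that makes their Euler product converge. -/
theorem summable_local_of_le {g : HeightOneSpectrum (𝓞 K) → ℕ → ℝ} {ρ B : ℝ} (hρ0 : 0 ≤ ρ)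
    (hρ : ρ < 1) (hg : ∀ v n, |g v (n + 1)| ≤ B * (primeNorm v ^ (-(3 / 2) : ℝ) * ρ ^ n)) :
    Summable fun p : HeightOneSpectrum (𝓞 K) × ℕ ↦ |g p.1 (p.2 + 1)| := by
  have h1 := summable_primeNorm_rpow (K := K) (s := 3 / 2) (by norm_num)
  have h2 := summable_geometric_of_lt_one hρ0 hρ
  have h3 := h1.mul_of_nonneg h2 (fun v ↦ Real.rpow_nonneg (primeNorm_pos v).le _)
    (fun n ↦ by positivity)
  exact (h3.mul_left B).of_nonneg_of_le (fun p ↦ abs_nonneg _) fun p ↦ hg p.1 p.2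

theorem hasProd_dedekindZeta {k : ℕ} (hk : 2 ≤ k) :
    HasProd (fun v : HeightOneSpectrum (𝓞 K) ↦ (1 - (primeNorm v ^ k)⁻¹)⁻¹)
      (∑' a : HeightOneSpectrum (𝓞 K) →₀ ℕ, normOf a ^ (-(k : ℝ))) := by
  have hle : ∀ v : HeightOneSpectrum (𝓞 K), 0 < (primeNorm v ^ k)⁻¹ ∧
      (primeNorm v ^ k)⁻¹ ≤ 1 / 2 := fun v ↦ by
    have h2 := two_le_primeNorm v
    have : 2 ^ 1 ≤ primeNorm v ^ k := by
      calc (2 : ℝ) ^ 1 ≤ primeNorm v ^ 1 := by gcongr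
        _ ≤ primeNorm v ^ k := pow_le_pow_right₀ (by linarith) (by omega)
    refine ⟨by have := primeNorm_pos v; positivity, ?_⟩
    rw [one_div]
    exact inv_anti₀ (by norm_num) (by linarith)
  have hdec : ∀ (v : HeightOneSpectrum (𝓞 K)) (n : ℕ), |((primeNorm v ^ k)⁻¹) ^ (n + 1)| ≤
      1 * (primeNorm v ^ (-(3 / 2) : ℝ) * (1 / 2 : ℝ) ^ n) := fun v n ↦ by
    rw [abs_of_nonneg (by have := (hle v).1; positivity), one_mul, pow_succ, mul_comm]
    have h1 : (primeNorm v ^ k)⁻¹ ≤ primeNorm v ^ (-(3 / 2) : ℝ) := by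
      rw [← Real.rpow_natCast, ← Real.rpow_neg (primeNorm_pos v).le]
      refine Real.rpow_le_rpow_of_exponent_le (by linarith [two_le_primeNorm v]) ?_
      have : (2 : ℝ) ≤ k := by exact_mod_cast hk
      linarith
    have h2 := (hle v).2
    have h3 := (hle v).1.le
    have h4 := Real.rpow_nonneg (primeNorm_pos v).le (-(3 / 2))
    gcongr
  have hsum := summable_local_of_le (g := fun v n ↦ ((primeNorm v ^ k)⁻¹) ^ n) (ρ := 1 / 2)
    (B := 1) (by norm_num) (by norm_num) hdec
  have h := (hasSum_finsupp_prod (g := fun (v : HeightOneSpectrum (𝓞 K)) n ↦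
    ((primeNorm v ^ k)⁻¹) ^ n) (fun v ↦ pow_zero _) hsum).2.1
  have e1 : ∀ v : HeightOneSpectrum (𝓞 K), ∑' n, ((primeNorm v ^ k)⁻¹) ^ n =
      (1 - (primeNorm v ^ k)⁻¹)⁻¹ := fun v ↦
    tsum_geometric_of_lt_one (hle v).1.le (by linarith [(hle v).2])
  have e2 : ∀ a : HeightOneSpectrum (𝓞 K) →₀ ℕ,
      (a.prod fun v n ↦ ((primeNorm v ^ k)⁻¹) ^ n) = normOf a ^ (-(k : ℝ)) := fun a ↦ by
    rw [Real.rpow_neg (normOf_pos a).le, Real.rpow_natCast, normOf, Finsupp.prod, Finsupp.prod,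
      ← Finset.prod_pow, ← Finset.prod_inv_distrib]
    refine Finset.prod_congr rfl fun v _ ↦ ?_
    rw [inv_pow, ← pow_mul, ← pow_mul, mul_comm]
  simpa only [e1, e2] using h

theorem tsum_normOf_pos {s : ℝ} (hs : 1 < s) :
    0 < ∑' a : HeightOneSpectrum (𝓞 K) →₀ ℕ, normOf a ^ (-s) := by
  refine (hasSum_normOf_rpow hs).summable.tsum_pos
    (fun a ↦ Real.rpow_nonneg (normOf_pos a).le _) 0 ?_
  exact Real.rpow_pos_of_pos (normOf_pos 0) _

end EulerProducts

/-! ### The convolution quotient and its Euler factors -/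

section LocalFactors

open Filter Topology

variable {K : Type*} [Field K] [NumberField K]

/-- The value of the irrational factor function at the `n`-th power of a prime ideal. -/
def localF (k : ℕ) (v : HeightOneSpectrum (𝓞 K)) (n : ℕ) : ℝ := primeNorm v ^ beta k n

/-- The local factor of the Dirichlet convolution quotient of the irrational factor function by the
norm. -/
def localH (k : ℕ) (v : HeightOneSpectrum (𝓞 K)) : ℕ → ℝ
  | 0 => 1
  | n + 1 => localF k v (n + 1) - primeNorm v * localF k v n

theorem localF_of_lt {k n : ℕ} (h : n < k) (v : HeightOneSpectrum (𝓞 K)) :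
    localF k v n = primeNorm v ^ n := by
  rw [localF, beta, if_pos h, Real.rpow_natCast]

theorem localF_add (k m : ℕ) (v : HeightOneSpectrum (𝓞 K)) :
    localF k v (m + k) = primeNorm v ^ (1 / ((k : ℝ) + m)) := by
  rw [localF, beta, if_neg (by omega)]
  push_cast
  rw [add_comm (m : ℝ)]

theorem localF_nonneg (k n : ℕ) (v : HeightOneSpectrum (𝓞 K)) : 0 ≤ localF k v n :=
  Real.rpow_nonneg (primeNorm_pos v).le _

theorem localF_le {k : ℕ} (hk : 2 ≤ k) (n : ℕ) (v : HeightOneSpectrum (𝓞 K)) :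
    localF k v n ≤ primeNorm v ^ n := by
  rw [localF, ← Real.rpow_natCast]
  refine Real.rpow_le_rpow_of_exponent_le (by linarith [two_le_primeNorm v]) ?_
  rw [beta]
  split_ifs with h
  · exact le_rfl
  · have h1 : (1 : ℝ) ≤ n := by
      have : 1 ≤ n := by omega
      exact_mod_cast this
    exact ((div_le_one₀ (by linarith)).2 h1).trans h1

/-- The sum telescopes: passing from `n` to `n + 1` multiplies the earlier terms by the prime norm,
and `localH` supplies the difference. -/
theorem sum_localH {k : ℕ} (hk : 2 ≤ k) (v : HeightOneSpectrum (𝓞 K)) (n : ℕ) :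
    ∑ j ∈ Finset.range (n + 1), localH k v j * primeNorm v ^ (n - j) = localF k v n := by
  induction n with
  | zero => simp [localH, localF_of_lt (show 0 < k by omega)]
  | succ n ih =>
    rw [Finset.sum_range_succ, Nat.sub_self, pow_zero, mul_one]
    have : ∑ j ∈ Finset.range (n + 1), localH k v j * primeNorm v ^ (n + 1 - j) =
        primeNorm v * localF k v n := by
      rw [← ih, Finset.mul_sum]
      refine Finset.sum_congr rfl fun j hj ↦ ?_
      rw [Nat.succ_sub (Nat.lt_succ_iff.1 (Finset.mem_range.1 hj)), pow_succ]
      ring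
    rw [this, localH]
    ring

theorem abs_localH_le {k : ℕ} (hk : 2 ≤ k) (n : ℕ) (v : HeightOneSpectrum (𝓞 K)) :
    |localH k v (n + 1)| ≤ primeNorm v ^ (n + 1) := by
  have h1 := localF_le hk (n + 1) v
  have h2 := mul_le_mul_of_nonneg_left (localF_le hk n v) (primeNorm_pos v).le
  rw [← pow_succ'] at h2
  have h3 := localF_nonneg k (n + 1) v
  have h4 := mul_nonneg (primeNorm_pos v).le (localF_nonneg k n v)
  rw [localH, abs_le]
  constructor <;> linarith

theorem localH_one {k : ℕ} (hk : 2 ≤ k) (v : HeightOneSpectrum (𝓞 K)) : localH k v 1 = 0 := by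
  rw [localH, localF_of_lt (by omega), localF_of_lt (by omega)]
  simp

/-- The coefficient at the prime itself vanishes, so decay starts at exponent two: `(N ^ (-θ)) ^ (m
+ 2)` is at most `N ^ (-3/2) * (2 ^ (-3/4)) ^ m`. Here `3/2 > 1` gives summability over primes. -/
theorem abs_localH_mul_le {k : ℕ} (hk : 2 ≤ k) {θ : ℝ} (hθ : 3 / 4 ≤ θ) (n : ℕ)
    (v : HeightOneSpectrum (𝓞 K)) :
    |localH k v (n + 1)| * (primeNorm v ^ (-(1 + θ))) ^ (n + 1) ≤
      2 * (primeNorm v ^ (-(3 / 2) : ℝ) * ((2 : ℝ) ^ (-(3 / 4) : ℝ)) ^ n) := by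
  have hN := two_le_primeNorm v
  have hN0 := primeNorm_pos v
  have hρ : (1 / 2 : ℝ) ≤ (2 : ℝ) ^ (-(3 / 4) : ℝ) := by
    calc (1 / 2 : ℝ) = (2 : ℝ) ^ (-1 : ℝ) := by rw [Real.rpow_neg_one]; norm_num
      _ ≤ _ := Real.rpow_le_rpow_of_exponent_le (by norm_num) (by norm_num)
  have hb0 := Real.rpow_nonneg hN0.le (-(3 / 2))
  cases n with
  | zero =>
    rw [localH_one hk]
    simp only [abs_zero, zero_mul]
    positivity
  | succ m =>
    have e : primeNorm v ^ (m + 1 + 1) * (primeNorm v ^ (-(1 + θ))) ^ (m + 1 + 1) =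
        (primeNorm v ^ (-θ)) ^ (m + 2) := by
      rw [← mul_pow]
      congr 1
      nth_rewrite 1 [← Real.rpow_one (primeNorm v)]
      rw [← Real.rpow_add hN0]
      ring_nf
    have h1 : primeNorm v ^ (-θ) ≤ primeNorm v ^ (-(3 / 4) : ℝ) :=
      Real.rpow_le_rpow_of_exponent_le (by linarith) (by linarith)
    have h2 : primeNorm v ^ (-(3 / 4) : ℝ) ≤ (2 : ℝ) ^ (-(3 / 4) : ℝ) :=
      Real.rpow_le_rpow_of_nonpos (by norm_num) hN (by norm_num)
    have h0 : 0 ≤ primeNorm v ^ (-(3 / 4) : ℝ) := Real.rpow_nonneg hN0.le _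
    have h00 : 0 ≤ primeNorm v ^ (-θ) := Real.rpow_nonneg hN0.le _
    have e2 : (primeNorm v ^ (-(3 / 4) : ℝ)) ^ 2 = primeNorm v ^ (-(3 / 2) : ℝ) := by
      rw [← Real.rpow_natCast, ← Real.rpow_mul hN0.le]
      norm_num
    calc _ ≤ primeNorm v ^ (m + 1 + 1) * (primeNorm v ^ (-(1 + θ))) ^ (m + 1 + 1) := by
          have := Real.rpow_nonneg hN0.le (-(1 + θ))
          gcongr
          exact abs_localH_le hk (m + 1) v
      _ = (primeNorm v ^ (-θ)) ^ (m + 2) := e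
      _ ≤ (primeNorm v ^ (-(3 / 4) : ℝ)) ^ (m + 2) := by gcongr
      _ = primeNorm v ^ (-(3 / 2) : ℝ) * (primeNorm v ^ (-(3 / 4) : ℝ)) ^ m := by
          rw [pow_add, e2, mul_comm]
      _ ≤ primeNorm v ^ (-(3 / 2) : ℝ) * ((2 : ℝ) ^ (-(3 / 4) : ℝ)) ^ m := by gcongr
      -- The factor `2` pays for raising the exponent from `m` to `m + 1`, since `2 ^ (-3/4) ≥ 1/2`.
      _ ≤ primeNorm v ^ (-(3 / 2) : ℝ) *
          (2 * ((2 : ℝ) ^ (-(3 / 4) : ℝ)) ^ (m + 1)) := by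
          have h3 : 0 ≤ ((2 : ℝ) ^ (-(3 / 4) : ℝ)) ^ m := by positivity
          gcongr
          rw [pow_succ]
          nlinarith
      _ = _ := by ring

theorem summable_localH {k : ℕ} (hk : 2 ≤ k) {θ : ℝ} (hθ : 3 / 4 ≤ θ) :
    Summable fun p : HeightOneSpectrum (𝓞 K) × ℕ ↦
      |localH k p.1 (p.2 + 1) * (primeNorm p.1 ^ (-(1 + θ))) ^ (p.2 + 1)| := by
  have h1 : (2 : ℝ) ^ (-(3 / 4) : ℝ) < 1 :=
    Real.rpow_lt_one_of_one_lt_of_neg (by norm_num) (by norm_num)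
  refine summable_local_of_le (g := fun v n ↦ localH k v n * (primeNorm v ^ (-(1 + θ))) ^ n)
    (ρ := (2 : ℝ) ^ (-(3 / 4) : ℝ)) (B := 2) (by positivity) h1 fun v n ↦ ?_
  rw [abs_mul, abs_of_nonneg (pow_nonneg (Real.rpow_nonneg (primeNorm_pos v).le _) _)]
  exact abs_localH_mul_le hk hθ n v

theorem prod_localH_mul (k : ℕ) (s : ℝ) (a : HeightOneSpectrum (𝓞 K) →₀ ℕ) :
    (a.prod fun v n ↦ localH k v n * (primeNorm v ^ s) ^ n) =
      a.prod (localH k) * normOf a ^ s := by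
  simp only [Finsupp.prod, normOf]
  rw [Finset.prod_mul_distrib, ← Real.finsetProd_rpow _ _
    fun v _ ↦ pow_nonneg (primeNorm_pos v).le _]
  congr 1
  refine Finset.prod_congr rfl fun v _ ↦ ?_
  rw [Real.rpow_pow_comm (primeNorm_pos v).le]

theorem summable_prod_localH {k : ℕ} (hk : 2 ≤ k) {θ : ℝ} (hθ : 3 / 4 ≤ θ) :
    Summable fun a : HeightOneSpectrum (𝓞 K) →₀ ℕ ↦
      a.prod (localH k) * normOf a ^ (-(1 + θ)) := by
  refine (hasSum_finsupp_prod (g := fun (v : HeightOneSpectrum (𝓞 K)) n ↦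
    localH k v n * (primeNorm v ^ (-(1 + θ))) ^ n) (fun v ↦ ?_) (summable_localH hk hθ)).2.2.2.congr
      fun a ↦ prod_localH_mul k _ a
  simp [localH]

/-- The terms of the numerator series of the local factor at `s = 2`, as real numbers. -/
def realLocalTerm (k : ℕ) (v : HeightOneSpectrum (𝓞 K)) (m : ℕ) : ℝ :=
  1 / primeNorm v ^ ((m : ℝ) * 2 + 1 / (k : ℝ) - 1 / ((k : ℝ) + (m : ℝ)))

/-- The local factor at `s = 2`, as a real number. -/
def realLocalA (k : ℕ) (v : HeightOneSpectrum (𝓞 K)) : ℝ :=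
  (1 / primeNorm v ^ ((k : ℝ) * 2 - 1 / (k : ℝ)) * ∑' m : ℕ, realLocalTerm k v m) /
    ∑ j ∈ Finset.range k, 1 / primeNorm v ^ j

theorem localTerm_two (k : ℕ) (v : HeightOneSpectrum (𝓞 K)) (m : ℕ) :
    localTerm k 2 v m = (realLocalTerm k v m : ℂ) := by
  rw [localTerm, realLocalTerm, Complex.ofReal_div,
    Complex.ofReal_cpow (primeNorm_pos v).le, primeNorm]
  push_cast
  rfl

theorem localA_two (k : ℕ) (v : HeightOneSpectrum (𝓞 K)) :
    localA k 2 v = (realLocalA k v : ℂ) := by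
  rw [localA, realLocalA]
  simp only [localTerm_two, ← Complex.ofReal_tsum]
  rw [Complex.ofReal_div, Complex.ofReal_mul, Complex.ofReal_div,
    Complex.ofReal_cpow (primeNorm_pos v).le, Complex.ofReal_sum, primeNorm]
  push_cast
  congr 1
  refine Finset.sum_congr rfl fun j _ ↦ ?_
  rw [← Complex.cpow_natCast]
  norm_num

theorem summable_localF_mul {k : ℕ} (hk : 2 ≤ k) (v : HeightOneSpectrum (𝓞 K)) :
    Summable fun n ↦ localF k v n * (primeNorm v ^ (-2 : ℝ)) ^ n := by
  have hN := two_le_primeNorm v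
  have hN0 := primeNorm_pos v
  have hlt : (primeNorm v)⁻¹ < 1 := inv_lt_one_of_one_lt₀ (by linarith)
  refine (summable_geometric_of_lt_one (by positivity) hlt).of_nonneg_of_le
    (fun n ↦ mul_nonneg (localF_nonneg k n v) (by positivity)) fun n ↦ ?_
  calc _ ≤ primeNorm v ^ n * (primeNorm v ^ (-2 : ℝ)) ^ n := by
        gcongr
        exact localF_le hk n v
    _ = ((primeNorm v)⁻¹) ^ n := by
        rw [← mul_pow]
        congr 1
        rw [Real.rpow_neg hN0.le, Real.rpow_two]
        field_simp

theorem localF_add_mul (k m : ℕ) (v : HeightOneSpectrum (𝓞 K)) :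
    localF k v (m + k) * (primeNorm v ^ (-2 : ℝ)) ^ (m + k) =
      1 / primeNorm v ^ ((k : ℝ) * 2 - 1 / (k : ℝ)) * realLocalTerm k v m := by
  have hN0 := primeNorm_pos v
  rw [localF_add, realLocalTerm, ← Real.rpow_natCast, ← Real.rpow_mul hN0.le,
    ← Real.rpow_add hN0, one_div_mul_one_div, ← Real.rpow_add hN0,
    one_div (primeNorm v ^ (_ : ℝ)), ← Real.rpow_neg hN0.le]
  congr 1
  push_cast
  ring

theorem summable_realLocalTerm {k : ℕ} (hk : 2 ≤ k) (v : HeightOneSpectrum (𝓞 K)) :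
    Summable (realLocalTerm k v) := by
  have h := (summable_nat_add_iff k).2 (summable_localF_mul hk v)
  simp only [localF_add_mul] at h
  refine (summable_mul_left_iff ?_).1 h
  have := Real.rpow_pos_of_pos (primeNorm_pos v) ((k : ℝ) * 2 - 1 / (k : ℝ))
  positivity

/-- Writing `N` for the prime norm, the `localH` series is `(1 - N⁻¹)` times the `localF` series.
The latter splits at `k` into the geometric sum `D` and a tail equal to `D * A_𝔭(2)`, and `(1 - N⁻¹)
* D = 1 - N ^ (-k)`. -/
theorem tsum_localH_mul {k : ℕ} (hk : 2 ≤ k) (v : HeightOneSpectrum (𝓞 K)) :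
    ∑' n, localH k v n * (primeNorm v ^ (-2 : ℝ)) ^ n =
      (1 - (primeNorm v ^ k)⁻¹) * (1 + realLocalA k v) := by
  have hN := two_le_primeNorm v
  have hN0 := primeNorm_pos v
  set q := primeNorm v ^ (-2 : ℝ) with hq
  have hq' : primeNorm v * q = (primeNorm v)⁻¹ := by
    rw [hq, Real.rpow_neg hN0.le, Real.rpow_two]
    field_simp
  have hF : Summable fun n ↦ localF k v n * q ^ n := summable_localF_mul hk v
  have hF1 : Summable fun n ↦ localF k v (n + 1) * q ^ (n + 1) := (summable_nat_add_iff 1).2 hF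
  set S := ∑' n, localF k v n * q ^ n with hS
  have hstep : ∀ n, localH k v (n + 1) * q ^ (n + 1) =
      localF k v (n + 1) * q ^ (n + 1) - (primeNorm v)⁻¹ * (localF k v n * q ^ n) := fun n ↦ by
    rw [← hq', localH, pow_succ]
    ring
  have hH : Summable fun n ↦ localH k v n * q ^ n := by
    rw [← summable_nat_add_iff 1]
    simp only [hstep]
    exact hF1.sub (hF.mul_left _)
  have hS0 : S = 1 + ∑' n, localF k v (n + 1) * q ^ (n + 1) := by
    rw [hS, hF.tsum_eq_zero_add, localF_of_lt (by omega)]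
    simp
  have h1 : ∑' n, localH k v n * q ^ n = (1 - (primeNorm v)⁻¹) * S := by
    rw [hH.tsum_eq_zero_add]
    simp only [hstep]
    rw [hF1.tsum_sub (hF.mul_left _), tsum_mul_left, ← hS]
    simp only [localH, pow_zero, mul_one]
    rw [hS0]
    ring
  set D := ∑ j ∈ Finset.range k, 1 / primeNorm v ^ j with hD
  have hD0 : 0 < D := Finset.sum_pos (fun j _ ↦ by positivity) ⟨0, by simp; omega⟩
  have h2 : S = D * (1 + realLocalA k v) := by
    rw [hS, ← hF.sum_add_tsum_nat_add k]
    have hadd : ∀ m, localF k v (m + k) * q ^ (m + k) =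
      1 / primeNorm v ^ ((k : ℝ) * 2 - 1 / (k : ℝ)) * realLocalTerm k v m :=
      fun m ↦ localF_add_mul k m v
    simp only [hadd]
    rw [tsum_mul_left, mul_add, mul_one, realLocalA, mul_div_cancel₀ _ hD0.ne']
    congr 1
    refine Finset.sum_congr rfl fun j hj ↦ ?_
    rw [localF_of_lt (Finset.mem_range.1 hj), ← mul_pow, hq', inv_pow, one_div]
  have h3 : (1 - (primeNorm v)⁻¹) * D = 1 - (primeNorm v ^ k)⁻¹ := by
    have := mul_neg_geom_sum (primeNorm v)⁻¹ k
    simpa only [hD, one_div, ← inv_pow] using this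
  rw [h1, h2, ← mul_assoc, h3]

variable (K) in
/-- The value at `s = 2` of the product of the Euler product `eulerR` and `1 / ζ(k)`, as a sum over
ideals. -/
def mainSum (k : ℕ) : ℝ :=
  ∑' a : HeightOneSpectrum (𝓞 K) →₀ ℕ, a.prod (localH k) * normOf a ^ (-2 : ℝ)

theorem hasProd_one_add_realLocalA {k : ℕ} (hk : 2 ≤ k) :
    HasProd (fun v : HeightOneSpectrum (𝓞 K) ↦ 1 + realLocalA k v)
      ((∑' a : HeightOneSpectrum (𝓞 K) →₀ ℕ, normOf a ^ (-(k : ℝ))) * mainSum K k) := by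
  have h1 := (hasSum_finsupp_prod (g := fun (v : HeightOneSpectrum (𝓞 K)) n ↦
    localH k v n * (primeNorm v ^ (-(1 + 1) : ℝ)) ^ n) (fun v ↦ by simp [localH])
      (summable_localH hk (θ := 1) (by norm_num))).2.1
  simp only [prod_localH_mul] at h1
  rw [show (-(1 + 1) : ℝ) = -2 by norm_num] at h1
  simp only [tsum_localH_mul hk] at h1
  have h2 := (hasProd_dedekindZeta (K := K) hk).mul h1
  have e : ∀ v : HeightOneSpectrum (𝓞 K), (1 - (primeNorm v ^ k)⁻¹)⁻¹ *
      ((1 - (primeNorm v ^ k)⁻¹) * (1 + realLocalA k v)) = 1 + realLocalA k v := fun v ↦ by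
    have : (primeNorm v ^ k)⁻¹ < 1 :=
      inv_lt_one_of_one_lt₀ (one_lt_pow₀ (by linarith [two_le_primeNorm v]) (by omega))
    rw [inv_mul_cancel_left₀ (by linarith)]
  simpa only [e, mainSum] using h2

theorem hasProd_one_add_localA {k : ℕ} (hk : 2 ≤ k) :
    HasProd (fun v : HeightOneSpectrum (𝓞 K) ↦ 1 + localA k 2 v)
      (dedekindZeta K k * (mainSum K k : ℂ)) := by
  have hk1 : (1 : ℝ) < k := by exact_mod_cast (by omega : 1 < k)
  have h := (hasProd_one_add_realLocalA (K := K) hk).map Complex.ofRealHom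
    Complex.continuous_ofReal
  have hz := dedekindZeta_eq_tsum_normOf (K := K) hk1
  rw [Complex.ofReal_natCast] at hz
  rw [hz, ← Complex.ofReal_mul]
  convert! h using 1
  ext v
  simp [localA_two]

end LocalFactors

/-! ### Assembling the asymptotic formula -/

section MainEstimate

variable (K : Type*) [Field K] [NumberField K]

theorem normSum_eq_zero {y : ℝ} (hy : y < 1) : normSum K y = 0 := by
  rw [normSum]
  refine Finset.sum_eq_zero fun a ha ↦ ?_
  have h1 := one_le_normOf a
  have h2 := mem_normBall.1 ha
  linarith

theorem exists_irrationalFactorSum_estimate {k : ℕ} (hk : 2 ≤ k) : ∃ C : ℝ, 0 < C ∧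
    ∀ x : ℝ, 0 < x →
      |irrationalFactorSum K k x - x ^ 2 * dedekindZeta_residue K * mainSum K k / 2| ≤
        C * x ^ (1 + countExp K) := by
  obtain ⟨C, hC, hest⟩ := exists_normSum_estimate K
  have hθ := le_countExp K
  have hW := (summable_prod_localH (K := K) hk hθ).abs
  have hT : Summable fun a : HeightOneSpectrum (𝓞 K) →₀ ℕ ↦
      a.prod (localH k) * normOf a ^ (-2 : ℝ) := by
    have h := summable_prod_localH (K := K) hk (θ := 1) (by norm_num)
    rwa [show (-(1 + 1) : ℝ) = -2 by norm_num] at h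
  set W := ∑' a : HeightOneSpectrum (𝓞 K) →₀ ℕ,
    |a.prod (localH k) * normOf a ^ (-(1 + countExp K))| with hWdef
  have hW0 : 0 ≤ W := tsum_nonneg fun a ↦ abs_nonneg _
  refine ⟨C * W + 1, by positivity, fun x hx ↦ ?_⟩
  -- Beyond norm `x` the inner sum is empty, so the finite sum becomes a series over all ideals and
  -- can be compared termwise with the main term, tail included.
  have hsupp : ∀ a ∉ normBall K x, a.prod (localH k) * normSum K (x / normOf a) = 0 := fun a ha ↦ by
    rw [mem_normBall, not_le] at ha
    rw [normSum_eq_zero K ((div_lt_one (normOf_pos a)).2 ha), mul_zero]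
  have hS : irrationalFactorSum K k x =
      ∑' a : HeightOneSpectrum (𝓞 K) →₀ ℕ, a.prod (localH k) * normSum K (x / normOf a) := by
    rw [irrationalFactorSum_eq, tsum_eq_sum hsupp]
    exact sum_prod_eq_sum_normSum (f := localF k) (sum_localH hk) (fun v ↦ rfl) x
  have hSs : Summable fun a : HeightOneSpectrum (𝓞 K) →₀ ℕ ↦
      a.prod (localH k) * normSum K (x / normOf a) := summable_of_ne_finset_zero hsupp
  have hM : x ^ 2 * dedekindZeta_residue K * mainSum K k / 2 =
      ∑' a : HeightOneSpectrum (𝓞 K) →₀ ℕ,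
        x ^ 2 * dedekindZeta_residue K / 2 * (a.prod (localH k) * normOf a ^ (-2 : ℝ)) := by
    rw [tsum_mul_left, mainSum]
    ring
  rw [hS, hM, ← hSs.tsum_sub (hT.mul_left _)]
  have hbound : ∀ a : HeightOneSpectrum (𝓞 K) →₀ ℕ,
      ‖a.prod (localH k) * normSum K (x / normOf a) -
        x ^ 2 * dedekindZeta_residue K / 2 * (a.prod (localH k) * normOf a ^ (-2 : ℝ))‖ ≤
      C * x ^ (1 + countExp K) *
        |a.prod (localH k) * normOf a ^ (-(1 + countExp K))| := fun a ↦ by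
    have hN := normOf_pos a
    have e1 : a.prod (localH k) * normSum K (x / normOf a) -
        x ^ 2 * dedekindZeta_residue K / 2 * (a.prod (localH k) * normOf a ^ (-2 : ℝ)) =
        a.prod (localH k) *
          (normSum K (x / normOf a) - dedekindZeta_residue K * (x / normOf a) ^ 2 / 2) := by
      rw [Real.rpow_neg hN.le, Real.rpow_two, div_pow]
      ring
    have e2 : (x / normOf a) ^ (1 + countExp K) =
        x ^ (1 + countExp K) * normOf a ^ (-(1 + countExp K)) := by
      rw [Real.div_rpow hx.le hN.le, Real.rpow_neg hN.le, div_eq_mul_inv]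
    have h1 := hest (x / normOf a) (by positivity)
    rw [e2] at h1
    rw [e1, Real.norm_eq_abs, abs_mul, abs_mul (a.prod (localH k)),
      abs_of_nonneg (Real.rpow_nonneg hN.le (-(1 + countExp K)))]
    calc _ ≤ |a.prod (localH k)| *
          (C * (x ^ (1 + countExp K) * normOf a ^ (-(1 + countExp K)))) := by gcongr
      _ = _ := by ring
  have h2 := tsum_of_norm_bounded (hW.mul_left (C * x ^ (1 + countExp K))).hasSum hbound
  rw [tsum_mul_left, ← hWdef, Real.norm_eq_abs] at h2
  refine h2.trans ?_
  have : 0 ≤ x ^ (1 + countExp K) := by positivity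
  nlinarith

/-- The power saving beats a logarithm because `log x ≤ x ^ (1 - θ) / (1 - θ)`. -/
theorem rpow_le_sq_div_log {θ : ℝ} (hθ : θ < 1) {x : ℝ} (hx : 2 ≤ x) :
    x ^ (1 + θ) ≤ (1 - θ)⁻¹ * (x ^ 2 / Real.log x) := by
  have hx0 : 0 < x := by linarith
  have hlog : 0 < Real.log x := Real.log_pos (by linarith)
  have h := Real.log_le_rpow_div hx0.le (sub_pos.2 hθ)
  have h1 : 0 < 1 - θ := sub_pos.2 hθ
  rw [mul_div_assoc', le_div_iff₀ hlog]
  calc x ^ (1 + θ) * Real.log x ≤ x ^ (1 + θ) * (x ^ (1 - θ) / (1 - θ)) := by gcongr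
    _ = (1 - θ)⁻¹ * (x ^ (1 + θ) * x ^ (1 - θ)) := by ring
    _ = (1 - θ)⁻¹ * x ^ 2 := by
        rw [← Real.rpow_add hx0, show 1 + θ + (1 - θ) = (2 : ℝ) by ring, Real.rpow_two]

end MainEstimate

end IrrationalFactor

end

theorem mainTheorem2 (K : Type*) [Field K] [NumberField K] (k : ℕ) (hk : 2 ≤ k) :
    (∀ 𝔭 : HeightOneSpectrum (𝓞 K), Summable (IrrationalFactor.localTerm k 2 𝔭)) ∧
    Multipliable (fun 𝔭 : HeightOneSpectrum (𝓞 K) ↦ 1 + IrrationalFactor.localA k 2 𝔭) ∧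
    ∃ C : ℝ, ∀ x : ℝ, 2 ≤ x →
      ‖(IrrationalFactor.irrationalFactorSum K k x : ℂ) -
          (x : ℂ) ^ 2 * (dedekindZeta_residue K : ℂ) * IrrationalFactor.eulerR K k 2 /
            (2 * dedekindZeta K (k : ℂ))‖ ≤
        C * (x ^ 2 / Real.log x) := by
  have hk1 : (1 : ℝ) < k := by exact_mod_cast (by omega : 1 < k)
  have hR := IrrationalFactor.hasProd_one_add_localA (K := K) hk
  refine ⟨fun v ↦ ?_, hR.multipliable, ?_⟩
  · refine (Complex.summable_ofReal.2 (IrrationalFactor.summable_realLocalTerm hk v)).congr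
      fun m ↦ ?_
    exact (IrrationalFactor.localTerm_two k v m).symm
  obtain ⟨C, hC, h⟩ := IrrationalFactor.exists_irrationalFactorSum_estimate K hk
  refine ⟨C * (1 - IrrationalFactor.countExp K)⁻¹, fun x hx ↦ ?_⟩
  have hz : dedekindZeta K (k : ℂ) ≠ 0 := by
    have h1 := IrrationalFactor.dedekindZeta_eq_tsum_normOf (K := K) hk1
    rw [Complex.ofReal_natCast] at h1
    rw [h1, Complex.ofReal_ne_zero]
    exact (IrrationalFactor.tsum_normOf_pos hk1).ne'
  -- The product `R_k(2)` equals `ζ_K(k)` times `mainSum`, so the zeta value cancels and the main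
  -- term is real.
  have e : (x : ℂ) ^ 2 * (dedekindZeta_residue K : ℂ) * IrrationalFactor.eulerR K k 2 /
      (2 * dedekindZeta K (k : ℂ)) =
      ((x ^ 2 * dedekindZeta_residue K * IrrationalFactor.mainSum K k / 2 : ℝ) : ℂ) := by
    rw [IrrationalFactor.eulerR, hR.tprod_eq]
    push_cast
    field_simp
  rw [e, ← Complex.ofReal_sub, Complex.norm_real, Real.norm_eq_abs]
  refine (h x (by linarith)).trans ?_
  rw [mul_assoc]
  gcongr
  exact IrrationalFactor.rpow_le_sq_div_log (IrrationalFactor.countExp_lt_one K) hx
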